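/- Let $\mathfrak A=\left(\frac{-1,-1}{\mathbb Q}\right)=\mathbb Q[u,v\mid u^2=v^2=-1,\ uv+vu=0]$ be the rational Hamilton quaternion algebra, let $w=\tfrac12(-1+u+v+uv)$, and let $G_H=\langle w,u,v\rangle\subseteq\mathfrak A^{*}$ be the Hurwitz unit group. For an algebraic extension $E$ of $\mathbb Q_p$, let $\mathcal O_E$ be the integral closure of $\mathbb Z_p$ in $E$ and let $e(E/\mathbb Q_p)\in\{1,2,\dots\}\cup\{\infty\}$ be the ramification index, i.e. the index of the value group of $\mathbb Q_p$ in that of $E$. If $E$ splits $\mathfrak A$, let $\rho:G_H\to\mathrm{GL}_2(E)$ be the representation obtained by restricting to $G_H$ an isomorphism of $E$-algebras $E\otimes_{\mathbb Q}\mathfrak A\cong\mathbb M_2(E)$, and let $\mathrm{IF}_\rho^{G_H}(E)$ be the set of $\mathrm{GL}_2(\mathcal O_E)$-conjugacy classes of representations $\rho':G_H\to\mathrm{GL}_2(\mathcal O_E)$ that are $\mathrm{GL}_2(E)$-conjugate to $\rho$. (1) Let $E$ be a Galois extension of $\mathbb Q_2$ containing a quadratic extension of $\mathbb Q_2$. Then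 $E$ splits $\mathfrak A$, and for every such $\rho$ the set $\mathrm{IF}_\rho^{G_H}(E)$ has exactly $e(E/\mathbb Q_2)+1$ elements if $\sqrt{-3}\in E$, while it is a singleton if $\sqrt{-3}\notin E$. (2) Let $p\neq 2$ be a prime and let $E$ be any algebraic extension of $\mathbb Q_p$. Then $E$ splits $\mathfrak A$, and for every such $\rho$ the set $\mathrm{IF}_\rho^{G_H}(E)$ is a singleton. -/

import Mathlib

open scoped TensorProduct Quaternion

noncomputable section

/-- The representations `ρ' : G → GL_n(R)` which become `GL_n(K)`-conjugate to `ρ : G → GL_n(K)`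
after extension of scalars from `R` to `K`. -/
def IntegralRep (R : Type*) [CommRing R] {K : Type*} [Field K] [Algebra R K]
    {G : Type*} [Group G] {n : ℕ} (ρ : G →* GL (Fin n) K) : Type _ :=
  {ρ' : G →* GL (Fin n) R //
    ∃ g : GL (Fin n) K, ∀ x : G,
      Matrix.GeneralLinearGroup.map (algebraMap R K) (ρ' x) = g * ρ x * g⁻¹}

/-- `GL_n(R)`-conjugacy of integral representations. -/
def integralRepSetoid (R : Type*) [CommRing R] {K : Type*} [Field K] [Algebra R K]
    {G : Type*} [Group G] {n : ℕ} (ρ : G →* GL (Fin n) K) : Setoid (IntegralRep R ρ) where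
  r ρ₁ ρ₂ := ∃ h : GL (Fin n) R, ∀ x : G, ρ₂.1 x = h * ρ₁.1 x * h⁻¹
  iseqv :=
    { refl := fun _ => ⟨1, fun x => by simp⟩
      symm := by
        rintro _ _ ⟨h, hh⟩
        exact ⟨h⁻¹, fun x => by rw [hh x]; group⟩
      trans := by
        rintro _ _ _ ⟨h, hh⟩ ⟨k, hk⟩
        exact ⟨k * h, fun x => by rw [hk x, hh x]; group⟩ }

/-- The set `IF_ρ^G` of integral forms of `ρ`: the `GL_n(R)`-conjugacy classes of representations
`G → GL_n(R)` that are `GL_n(K)`-conjugate to `ρ`. -/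
def IntegralForms (R : Type*) [CommRing R] {K : Type*} [Field K] [Algebra R K]
    {G : Type*} [Group G] {n : ℕ} (ρ : G →* GL (Fin n) K) : Type _ :=
  Quotient (integralRepSetoid R ρ)

/-- The ring of integers `𝒪_E` of an algebraic extension `E` of `ℚ_p`: the integral closure of
`ℤ_p` in `E`. -/
abbrev padicIntegers (p : ℕ) [Fact p.Prime] (E : Type*) [Field E] [Algebra ℚ_[p] E] :
    Subalgebra (PadicInt.subring p) E :=
  integralClosure (PadicInt.subring p) E

/-- The ramification index `e(E/ℚ_p)` of an algebraic extension `E` of `ℚ_p`, that is, the index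
`(v(Eˣ) : v(ℚ_pˣ))` of value groups. The valuation `v` is the projection onto its value group
`v(Eˣ) = Eˣ/𝒪_Eˣ`, so this is the index of `ℚ_pˣ 𝒪_Eˣ` in `Eˣ`. It is `⊤` when the index is
infinite, which can only happen for infinite extensions. -/
def ramificationIndex (p : ℕ) [Fact p.Prime] (E : Type*) [Field E] [Algebra ℚ_[p] E] : ℕ∞ :=
  ENat.card (Eˣ ⧸
    ((Units.map (algebraMap ℚ_[p] E : ℚ_[p] →* E)).range ⊔
      (Units.map (algebraMap (padicIntegers p E) E : padicIntegers p E →* E)).range))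

/-- The quaternion `𝐮` of `𝔄 = (-1,-1 / ℚ)`, as a unit. -/
def hurwitzU : ℍ[ℚ]ˣ :=
  Units.mk0 ⟨0, 1, 0, 0⟩ fun h => by simpa using congrArg QuaternionAlgebra.imI h

/-- The quaternion `𝐯` of `𝔄 = (-1,-1 / ℚ)`, as a unit. -/
def hurwitzV : ℍ[ℚ]ˣ :=
  Units.mk0 ⟨0, 0, 1, 0⟩ fun h => by simpa using congrArg QuaternionAlgebra.imJ h

/-- The quaternion `𝐰 = (-1 + 𝐮 + 𝐯 + 𝐮𝐯)/2` of `𝔄 = (-1,-1 / ℚ)`, as a unit. -/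
def hurwitzW : ℍ[ℚ]ˣ :=
  Units.mk0 ⟨-1 / 2, 1 / 2, 1 / 2, 1 / 2⟩ fun h => by
    simpa using congrArg QuaternionAlgebra.imI h

/-- The Hurwitz unit group `G_H = ⟨𝐰, 𝐮, 𝐯⟩`. -/
def hurwitzGroup : Subgroup ℍ[ℚ]ˣ :=
  Subgroup.closure {hurwitzW, hurwitzU, hurwitzV}

/-- The splittings over `E` of the rational Hamilton quaternion algebra `𝔄 = (-1,-1 / ℚ)`: the
isomorphisms of `E`-algebras `𝔄_E = E ⊗ 𝔄 ≅ M₂(E)`. -/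
abbrev HamiltonSplitting (E : Type*) [Field E] [CharZero E] : Type _ :=
  E ⊗[ℚ] ℍ[ℚ] ≃ₐ[E] Matrix (Fin 2) (Fin 2) E

/-- The representation `ρ : G_H → GL₂(E)` obtained by extending scalars to `E`, through a splitting
`𝔄_E ≅ M₂(E)`. -/
def hurwitzRep {E : Type*} [Field E] [CharZero E] (f : HamiltonSplitting E) :
    hurwitzGroup →* GL (Fin 2) E :=
  (Units.map
    ((f.toAlgHom.toRingHom.comp
      (Algebra.TensorProduct.includeRight : ℍ[ℚ] →ₐ[ℚ] E ⊗[ℚ] ℍ[ℚ]).toRingHom) :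
        ℍ[ℚ] →* Matrix (Fin 2) (Fin 2) E)).comp hurwitzGroup.subtype

end

/-! Extend the `p`-adic absolute value to `E`; it cuts out `𝒪_E`, which is local. `E` splits the
quaternions as soon as `-1` is a sum of two squares in `E` (`nonempty_hamiltonSplitting`). For odd
`p` Hensel gives this already in `ℤ_p`. For `p = 2`, every `d` with `-d` outside the square class of
`-1` has `-d` a sum of three squares, so a quadratic subfield makes `-1` a quotient of sums of two
squares, hence such a sum.

The group is generated by `𝐰` and `𝐮`, and the traces and determinants of the matrices `W`, `U`, `V`
of `𝐰`, `𝐮`, `𝐯` and of their products are known rationals. Each count comes from normalising one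
matrix over `𝒪_E` and seeing what freedom the others keep.

If `ω ∈ E` and `p = 2`, then `3` is a unit and `W` becomes `diag(ω, ω²)`. The diagonal of `U` is
then forced, and its off-diagonal entries satisfy `qr = -2/3`. What remains is conjugation by
diagonal matrices, which scales `q` by a unit, so the class is `|q|`, an arbitrary value with `1/2 ≤
|q| ≤ 1`. Values in `(1/2, 1]` represent the value group modulo that of `ℚ_2` and number `e`; the
endpoint `1/2` adds one.

If `ω ∉ E` and `p = 2`, a Galois conjugation argument shows that `X² + X + 1` takes unit values on
`𝒪_E`. Then `W` has a companion form, and the norm form `x² - xy + y²` is anisotropic modulo the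
maximal ideal. This makes `U` integral, and an intertwiner `a + bW` over `E` becomes invertible over
`𝒪_E` after scaling.

If `p` is odd, then `2` is a unit, and diagonalising an involution in the span of `V` and `UV`
brings every form to one fixed model; `p = 3` needs no separate treatment. -/

noncomputable section

/-! ### The absolute value on an algebraic extension of `ℚ_p` and its ring of integers -/

section SpectralAbs

variable (p : ℕ) [Fact p.Prime] (E : Type*) [Field E] [Algebra ℚ_[p] E]
  [Algebra.IsAlgebraic ℚ_[p] E]

/-- The absolute value of an algebraic extension of `ℚ_p` extending the `p`-adic one. -/
def padicAbs : AbsoluteValue E ℝ where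
  toFun := spectralNorm ℚ_[p] E
  map_mul' := spectralAlgNorm_mul
  nonneg' := spectralNorm_nonneg
  eq_zero' x := ⟨fun h => eq_zero_of_map_spectralNorm_eq_zero h (Algebra.IsAlgebraic.isAlgebraic x),
    fun h => by rw [h, spectralNorm_zero]⟩
  add_le' x y := map_add_le_add (spectralMulAlgNorm ℚ_[p] E) x y

variable {E}

theorem padicAbs_add_le (x y : E) :
    padicAbs p E (x + y) ≤ max (padicAbs p E x) (padicAbs p E y) :=
  isNonarchimedean_spectralNorm x y

theorem padicAbs_algebraMap (x : ℚ_[p]) : padicAbs p E (algebraMap ℚ_[p] E x) = ‖x‖ :=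
  spectralNorm_extends x

theorem padicAbs_natCast (n : ℕ) : padicAbs p E (n : E) = ‖(n : ℚ_[p])‖ := by
  rw [← padicAbs_algebraMap p (E := E), map_natCast (algebraMap ℚ_[p] E)]

theorem padicAbs_intCast (n : ℤ) : padicAbs p E (n : E) = ‖(n : ℚ_[p])‖ := by
  rw [← padicAbs_algebraMap p (E := E), map_intCast (algebraMap ℚ_[p] E)]

theorem padicAbs_le_one_of_mem {x : E} (hx : x ∈ padicIntegers p E) : padicAbs p E x ≤ 1 := by
  obtain ⟨P, hP, hx⟩ := hx
  by_contra! h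
  have hpos : 0 < padicAbs p E x := one_pos.trans h
  rw [← Polynomial.aeval_def, Polynomial.aeval_eq_sum_range, Finset.sum_range_succ,
    hP.coeff_natDegree, one_smul] at hx
  -- The lower terms of a monic equation are dominated by `|x| ^ (deg - 1)`. For `m = 0` the
  -- truncated exponent is harmless, the sum being empty.
  have key : ∀ m : ℕ, padicAbs p E (∑ i ∈ Finset.range m, P.coeff i • x ^ i) ≤
      padicAbs p E x ^ (m - 1) := by
    intro m
    induction m with
    | zero => simp
    | succ k ih =>
      rw [Finset.sum_range_succ]
      refine (padicAbs_add_le p _ _).trans (max_le (ih.trans ?_) ?_)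
      · exact pow_le_pow_right₀ h.le (by omega)
      · have : P.coeff k • x ^ k = algebraMap ℚ_[p] E (P.coeff k : ℚ_[p]) * x ^ k := by
          rw [Algebra.smul_def]; rfl
        rw [this, map_mul, map_pow, padicAbs_algebraMap, Nat.add_sub_cancel]
        exact mul_le_of_le_one_left (by positivity) (P.coeff k).2
  rcases Nat.eq_zero_or_pos P.natDegree with h0 | h0
  · rw [h0] at hx
    simp at hx
  · have h1 := key P.natDegree
    rw [eq_neg_of_add_eq_zero_left hx, map_neg_eq_map, map_pow] at h1
    exact absurd h1 (not_le.2 (pow_lt_pow_right₀ h (by omega)))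

/-- The spectral norm is read off the coefficients of the minimal polynomial, so a value at most `1`
means precisely that this polynomial lifts to `ℤ_p`. -/
theorem mem_padicIntegers_iff {x : E} : x ∈ padicIntegers p E ↔ padicAbs p E x ≤ 1 := by
  refine ⟨padicAbs_le_one_of_mem p, fun h => ?_⟩
  have hint : IsIntegral ℚ_[p] x := Algebra.IsIntegral.isIntegral x
  have hm := minpoly.monic hint
  have hc := (spectralValue_le_one_iff hm).1 h
  have hl : minpoly ℚ_[p] x ∈ Polynomial.lifts (algebraMap (PadicInt.subring p) ℚ_[p]) := by
    rw [Polynomial.lifts_iff_coeff_lifts]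
    exact fun n => ⟨⟨_, hc n⟩, rfl⟩
  obtain ⟨Q, hQ, -, hQm⟩ := Polynomial.lifts_and_degree_eq_and_monic hl hm
  refine ⟨Q, hQm, ?_⟩
  have : algebraMap (PadicInt.subring p) E =
    (algebraMap ℚ_[p] E).comp (algebraMap (PadicInt.subring p) ℚ_[p]) := rfl
  rw [this, ← Polynomial.eval₂_map, hQ]
  exact minpoly.aeval _ _

theorem padicAbs_le_one_iff_range (x : E) :
    padicAbs p E x ≤ 1 ↔ x ∈ Set.range (algebraMap (padicIntegers p E) E) := by
  rw [← mem_padicIntegers_iff]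
  exact ⟨fun h => ⟨⟨x, h⟩, rfl⟩, by rintro ⟨y, rfl⟩; exact y.2⟩

end SpectralAbs

/-! ### Rings that are unit balls of an absolute value -/

section AbsInteger

variable {R E : Type*} [CommRing R] [Field E] [Algebra R E] {N : AbsoluteValue E ℝ}

theorem isUnit_iff_abs_eq_one (hinj : Function.Injective (algebraMap R E))
    (hR : ∀ x, N x ≤ 1 ↔ x ∈ Set.range (algebraMap R E)) (x : R) :
    IsUnit x ↔ N (algebraMap R E x) = 1 := by
  constructor
  · rintro ⟨u, rfl⟩
    have h1 := (hR _).2 ⟨(u : R), rfl⟩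
    have h2 := (hR _).2 ⟨((u⁻¹ : Rˣ) : R), rfl⟩
    have h3 : N (algebraMap R E u) * N (algebraMap R E ((u⁻¹ : Rˣ) : R)) = 1 := by
      rw [← map_mul, ← map_mul, Units.mul_inv, map_one, map_one]
    nlinarith [N.nonneg (algebraMap R E u)]
  · intro h
    have h0 : algebraMap R E x ≠ 0 := fun h0 => by simp [h0] at h
    obtain ⟨y, hy⟩ := (hR (algebraMap R E x)⁻¹).1 (by rw [map_inv₀, h, inv_one])
    exact IsUnit.of_mul_eq_one y (hinj (by rw [map_mul, hy, mul_inv_cancel₀ h0, map_one]))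

/-- Since `a + (1 - a) = 1`, the ultrametric inequality forces `a` or `1 - a` to have absolute value
`1`. -/
theorem isLocalRing_of_abs (hN : ∀ x y, N (x + y) ≤ max (N x) (N y))
    (hinj : Function.Injective (algebraMap R E))
    (hR : ∀ x, N x ≤ 1 ↔ x ∈ Set.range (algebraMap R E)) : IsLocalRing R := by
  have : Nontrivial R := ⟨0, 1, fun h => zero_ne_one (α := E) (by
    rw [← map_zero (algebraMap R E), h, map_one])⟩
  refine IsLocalRing.of_isUnit_or_isUnit_one_sub_self fun a => ?_
  rw [isUnit_iff_abs_eq_one hinj hR, isUnit_iff_abs_eq_one hinj hR]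
  have h := hN (algebraMap R E a) (algebraMap R E (1 - a))
  rw [← map_add, add_sub_cancel, map_one, map_one] at h
  rcases le_max_iff.1 h with h | h
  · exact Or.inl (le_antisymm ((hR _).2 ⟨a, rfl⟩) h)
  · exact Or.inr (le_antisymm ((hR _).2 ⟨1 - a, rfl⟩) h)

end AbsInteger

/-! ### Cube roots of unity in the residue field -/

/-- If the residue field contains a root of `X² + X + 1`, so does `E`. -/
theorem padicAbs_sq_add_self_add_one {E : Type*} [Field E] [Algebra ℚ_[2] E]
    [Algebra.IsAlgebraic ℚ_[2] E] (hω : ∀ x : E, x ^ 2 + x + 1 ≠ 0) {x : E}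
    (hx : padicAbs 2 E x ≤ 1) : padicAbs 2 E (x ^ 2 + x + 1) = 1 := by
  let L := AlgebraicClosure E
  have : Algebra.IsAlgebraic ℚ_[2] L := Algebra.IsAlgebraic.trans ℚ_[2] E L
  have hEL : ∀ y : E, padicAbs 2 L (algebraMap E L y) = padicAbs 2 E y := fun y =>
    (spectralNorm.eq_of_tower (K := ℚ_[2]) (L := L) y).symm
  obtain ⟨w, hw⟩ : ∃ w : L, w ^ 2 + w + 1 = 0 := by
    obtain ⟨w, hw⟩ := IsAlgClosed.exists_root
      (Polynomial.X ^ 2 + Polynomial.X + 1 : Polynomial L) (by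
        rw [show (Polynomial.X ^ 2 + Polynomial.X + 1 : Polynomial L).degree = 2 by compute_degree!]
        decide)
    exact ⟨w, by simpa using hw⟩
  let P : Polynomial E := Polynomial.X ^ 2 + Polynomial.X + 1
  have hPd : P.natDegree = 2 := by simp only [P]; compute_degree!
  have hPm : P.Monic := by simp only [P]; monicity!
  have hPi : Irreducible P := by
    rw [hPm.irreducible_iff_roots_eq_zero_of_degree_le_three (by omega) (by omega)]
    refine Multiset.eq_zero_of_forall_notMem fun y hy => hω y ?_
    have := (Polynomial.mem_roots'.1 hy).2
    simpa [P] using this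
  have hmin : ∀ z : L, z ^ 2 + z + 1 = 0 → minpoly E z = P := fun z hz =>
    (minpoly.eq_of_irreducible_of_monic hPi (by simpa [P] using hz) hPm).symm
  -- The automorphism exchanging the two roots fixes `E` and preserves the norm, so `a` is equally
  -- far from both.
  have hconj : IsConjRoot E w (-1 - w) := by
    rw [IsConjRoot, hmin w hw, hmin _ (by linear_combination hw)]
  obtain ⟨σ, hσ⟩ := isConjRoot_iff_exists_algEquiv.1 hconj
  set a := algebraMap E L x with ha
  have h1 : padicAbs 2 L (a - w) = padicAbs 2 L (a + 1 + w) := by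
    have h := spectralNorm_eq_of_equiv (σ.restrictScalars ℚ_[2]) (a + 1 + w)
    have h2 : (σ.restrictScalars ℚ_[2]) (a + 1 + w) = a - w := by
      have hs : σ w = -1 - w := by
        have h3 := hσ
        rw [map_sub, map_neg, map_one] at h3
        linear_combination -h3
      change σ (a + 1 + w) = a - w
      rw [map_add, map_add, map_one, hs, ha, AlgEquiv.commutes]; ring
    rw [h2] at h
    exact h.symm
  have h2 : padicAbs 2 E (x ^ 2 + x + 1) = padicAbs 2 L (a - w) ^ 2 := by
    rw [← hEL, sq (padicAbs 2 L _)]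
    nth_rewrite 2 [h1]
    rw [← map_mul]
    congr 1
    simp only [map_add, map_pow, map_one, ← ha]
    linear_combination hw
  have hw1 : padicAbs 2 L (1 + w + w) = 1 := by
    have h3 : padicAbs 2 L (1 + w + w) ^ 2 = 1 := by
      rw [← map_pow, show (1 + w + w) ^ 2 = ((-3 : ℤ) : L) by push_cast; linear_combination 4 * hw,
        padicAbs_intCast]
      have h4 : ¬ ((2 : ℕ) : ℤ) ∣ (-3 : ℤ) := by decide
      rw [← Padic.norm_intCast_lt_one_iff (p := 2)] at h4
      exact le_antisymm (Padic.norm_int_le_one _) (not_lt.1 h4)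
    nlinarith [(padicAbs 2 L).nonneg (1 + w + w)]
  -- The roots differ by `1 + 2w`, a square root of `-3`, of absolute value `1`; a point equidistant
  -- from both cannot be closer than that.
  have h5 : 1 ≤ padicAbs 2 L (a - w) := by
    have h := padicAbs_add_le 2 (a + 1 + w) (-(a - w))
    rw [map_neg_eq_map, ← h1, max_self, show a + 1 + w + -(a - w) = 1 + w + w by ring, hw1] at h
    exact h
  refine le_antisymm ?_ ?_
  · rw [← mem_padicIntegers_iff] at hx ⊢
    exact add_mem (add_mem (pow_mem hx 2) hx) (one_mem _)
  · rw [h2]; nlinarith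

/-! ### Splitting the quaternions and sums of two squares -/

/-- The Hamilton quaternions split over `E` if `-1` is a sum of two squares in `E`. -/
theorem nonempty_hamiltonSplitting {E : Type*} [Field E] [CharZero E] {a b : E}
    (hab : a ^ 2 + b ^ 2 = -1) : Nonempty (HamiltonSplitting E) := by
  let B : QuaternionAlgebra.Basis (Matrix (Fin 2) (Fin 2) E) (-1 : ℚ) 0 (-1) :=
    { i := !![0, -1; 1, 0]
      j := !![a, b; b, -a]
      k := !![-b, a; a, b]
      i_mul_i := by
        ext i j
        fin_cases i <;> fin_cases j <;> simp [Matrix.mul_apply]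
      j_mul_j := by
        ext i j
        fin_cases i <;> fin_cases j <;> simp [Matrix.mul_apply] 
        · linear_combination hab
        · ring
        · ring
        · linear_combination hab
      i_mul_j := by
        ext i j
        fin_cases i <;> fin_cases j <;> simp [Matrix.mul_apply]
      j_mul_i := by
        ext i j
        fin_cases i <;> fin_cases j <;> simp [Matrix.mul_apply] }
  let φ : ℍ[ℚ] →ₐ[ℚ] Matrix (Fin 2) (Fin 2) E := B.liftHom
  let F : E ⊗[ℚ] ℍ[ℚ] →ₐ[E] Matrix (Fin 2) (Fin 2) E :=
    Algebra.TensorProduct.lift (Algebra.ofId E _) φ fun x y => Algebra.commutes x (φ y)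
  have hφ : ∀ q : ℍ[ℚ], φ q = !![(q.re : E) + q.imJ * a - q.imK * b,
      -q.imI + q.imJ * b + q.imK * a; q.imI + q.imJ * b + q.imK * a,
      q.re - q.imJ * a + q.imK * b] := by
    intro q
    have h : φ q = algebraMap ℚ _ q.re + q.imI • B.i + q.imJ • B.j + q.imK • B.k := rfl
    rw [h]
    ext i j
    fin_cases i <;> fin_cases j <;>
      simp [B, Matrix.algebraMap_matrix_apply, Rat.smul_def] <;>
      ring
  have hF : ∀ (c : E) (q : ℍ[ℚ]), F (c ⊗ₜ q) = c • φ q := fun c q =>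
    (Algebra.TensorProduct.lift_tmul _ _ _ c q).trans (Algebra.smul_def c (φ q)).symm
  have hsurj : Function.Surjective F := by
    intro M
    let m := (M 0 0 - M 1 1) / 2
    let n := (M 0 1 + M 1 0) / 2
    obtain ⟨qi, hi⟩ : ∃ q : ℍ[ℚ], φ q = !![0, -1; 1, 0] := ⟨⟨0, 1, 0, 0⟩, (hφ _).trans (by simp)⟩
    obtain ⟨qj, hj⟩ : ∃ q : ℍ[ℚ], φ q = !![a, b; b, -a] := ⟨⟨0, 0, 1, 0⟩, (hφ _).trans (by simp)⟩
    obtain ⟨qk, hk⟩ : ∃ q : ℍ[ℚ], φ q = !![-b, a; a, b] := ⟨⟨0, 0, 0, 1⟩, (hφ _).trans (by simp)⟩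
    -- The trace and the skew part give the first two coefficients. The other two solve a linear
    -- system for the symmetric traceless part whose determinant is `a² + b² = -1`.
    refine ⟨((M 0 0 + M 1 1) / 2) ⊗ₜ 1 + ((M 1 0 - M 0 1) / 2) ⊗ₜ qi +
      (-(a * m + b * n)) ⊗ₜ qj + (b * m - a * n) ⊗ₜ qk, ?_⟩
    simp only [map_add, hF, hi, hj, hk, map_one]
    ext i j
    fin_cases i <;> fin_cases j <;> simp [m, n]
    · linear_combination (-(M 0 0 - M 1 1) / 2) * hab
    · linear_combination (-(M 0 1 + M 1 0) / 2) * hab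
    · linear_combination (-(M 0 1 + M 1 0) / 2) * hab
    · linear_combination ((M 0 0 - M 1 1) / 2) * hab
  have hd : Module.finrank E (E ⊗[ℚ] ℍ[ℚ]) = Module.finrank E (Matrix (Fin 2) (Fin 2) E) := by
    rw [Module.finrank_baseChange, Quaternion.finrank_eq_four, Module.finrank_matrix]
    simp
  have hinj : Function.Injective F :=
    (LinearMap.injective_iff_surjective_of_finrank_eq_finrank (f := F.toLinearMap) hd).2 hsurj
  exact ⟨AlgEquiv.ofBijective F ⟨hinj, hsurj⟩⟩

/-- For odd `p`, `-1` is a sum of two squares in `ℤ_p`. -/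
theorem PadicInt.exists_sq_add_sq_eq_neg_one (p : ℕ) [Fact p.Prime] (hp : p ≠ 2) :
    ∃ a b : ℤ_[p], a ^ 2 + b ^ 2 = -1 := by
  -- A nonzero first coordinate makes the root simple for Hensel's lemma; if it vanishes, swap the
  -- two.
  obtain ⟨a, b, ha, hab⟩ : ∃ a b : ZMod p, a ≠ 0 ∧ a ^ 2 + b ^ 2 = -1 := by
    obtain ⟨a, b, hab⟩ := ZMod.sq_add_sq p (-1)
    by_cases ha : a = 0
    · refine ⟨b, a, fun hb => ?_, by rw [← hab]; ring⟩
      simp [ha, hb] at hab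
    · exact ⟨a, b, ha, hab⟩
  obtain ⟨x, rfl⟩ := ZMod.ringHom_surjective (PadicInt.toZMod (p := p)) a
  obtain ⟨y, rfl⟩ := ZMod.ringHom_surjective (PadicInt.toZMod (p := p)) b
  have hlt : ∀ z : ℤ_[p], ‖z‖ < 1 ↔ PadicInt.toZMod z = 0 := fun z => by
    rw [← RingHom.mem_ker, PadicInt.ker_toZMod, IsLocalRing.mem_maximalIdeal, PadicInt.mem_nonunits]
  let P : Polynomial ℤ_[p] := Polynomial.X ^ 2 + Polynomial.C (y ^ 2 + 1)
  have hP : P.derivative.aeval x = 2 * x := by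
    rw [Polynomial.derivative_add, Polynomial.derivative_C]
    simp [one_add_one_eq_two]
  have h2 : (2 : ZMod p) ≠ 0 := by
    have : NeZero p := ⟨(Fact.out : p.Prime).ne_zero⟩
    exact (Ring.two_ne_zero (by rwa [ZMod.ringChar_zmod_n]))
  have h1 : ‖(2 * x : ℤ_[p])‖ = 1 := by
    refine le_antisymm (PadicInt.norm_le_one _) (not_lt.1 fun h => ?_)
    rw [hlt, map_mul, map_ofNat] at h
    exact mul_ne_zero h2 ha h
  obtain ⟨z, hz, -⟩ := hensels_lemma (F := P) (a := x) (by
    rw [hP, h1, one_pow, hlt]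
    simp only [P, map_add, map_pow, Polynomial.aeval_X, Polynomial.aeval_C, map_one,
      Algebra.algebraMap_self, RingHom.id_apply]
    linear_combination hab)
  refine ⟨z, y, ?_⟩
  simp only [P, map_add, map_pow, Polynomial.aeval_X, Polynomial.aeval_C, map_one,
    Algebra.algebraMap_self, RingHom.id_apply] at hz
  linear_combination hz

/-- Units of `ℤ_2` which agree modulo 8 differ by a square. -/
theorem PadicInt.exists_eq_mul_sq (m : ℤ_[2]) (n : ℤ_[2]) (hn : ‖n‖ = 1)
    (h : ‖m - n‖ ≤ 1 / 8) : ∃ t : ℤ_[2], m = n * t ^ 2 := by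
  let P : Polynomial ℤ_[2] := Polynomial.C n * Polynomial.X ^ 2 - Polynomial.C m
  have hP : P.derivative.aeval (1 : ℤ_[2]) = n * 2 := by simp [P, one_add_one_eq_two]
  have h2 : ‖(2 : ℤ_[2])‖ = 1 / 2 := by
    have := PadicInt.norm_p (p := 2)
    norm_num at this ⊢
    exact this
  -- Hensel applies as `|P(1)| ≤ 1/8 < 1/4 = |P'(1)|²`.
  obtain ⟨z, hz, -⟩ := hensels_lemma (F := P) (a := 1) (by
    rw [hP, norm_mul, hn, h2]
    simp only [P, map_sub, map_mul, map_pow, Polynomial.aeval_X, Polynomial.aeval_C,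
      Algebra.algebraMap_self, RingHom.id_apply]
    rw [one_pow, mul_one, ← norm_neg, neg_sub]
    norm_num at h ⊢
    linarith)
  refine ⟨z, ?_⟩
  simp only [P, map_sub, map_mul, map_pow, Polynomial.aeval_X, Polynomial.aeval_C,
    Algebra.algebraMap_self, RingHom.id_apply] at hz
  linear_combination -hz

/-- Modulo squares, units of `ℤ_2` are classified by their residue modulo 8. The representatives
`1`, `3`, `5` are sums of at most three squares; `7` is written `-1` because that class is the
exceptional one. -/
theorem PadicInt.exists_odd_eq_mul_sq (m : ℤ_[2]) (hm : ‖m‖ = 1) :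
    ∃ t : ℤ_[2], m = t ^ 2 ∨ m = 3 * t ^ 2 ∨ m = 5 * t ^ 2 ∨ m = - t ^ 2 := by
  have key : ∀ k : ZMod (2 ^ 3), (IsUnit k → k = 1 ∨ k = 3 ∨ k = 5 ∨ k = -1) := by decide
  have hk := key (PadicInt.toZModPow 3 m) ((PadicInt.isUnit_iff.2 hm).map _)
  have hle : ∀ n : ℤ, ¬ (2 : ℤ) ∣ n → PadicInt.toZModPow 3 m = n →
      ∃ t : ℤ_[2], m = n * t ^ 2 := by
    intro n hn h
    apply PadicInt.exists_eq_mul_sq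
    · refine le_antisymm (PadicInt.norm_le_one _) (not_lt.1 fun h => hn ?_)
      exact_mod_cast (PadicInt.norm_int_lt_one_iff_dvd n).1 h
    · have h1 : m - n ∈ RingHom.ker (PadicInt.toZModPow (p := 2) 3) := by
        rw [RingHom.mem_ker, map_sub, h, map_intCast, sub_self]
      rw [PadicInt.ker_toZModPow, ← PadicInt.norm_le_pow_iff_mem_span_pow] at h1
      norm_num at h1 ⊢
      exact h1
  rcases hk with h | h | h | h
  · obtain ⟨t, ht⟩ := hle 1 (by decide) (by simpa using h)
    exact ⟨t, Or.inl (by simpa using ht)⟩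
  · obtain ⟨t, ht⟩ := hle 3 (by decide) (by simpa using h)
    exact ⟨t, Or.inr (Or.inl (by simpa using ht))⟩
  · obtain ⟨t, ht⟩ := hle 5 (by decide) (by simpa using h)
    exact ⟨t, Or.inr (Or.inr (Or.inl (by simpa using ht)))⟩
  · obtain ⟨t, ht⟩ := hle (-1) (by decide) (by simpa using h)
    exact ⟨t, Or.inr (Or.inr (Or.inr (by simpa using ht)))⟩

/-- A nonzero `2`-adic number is the negative of a square, or a square multiple of a sum of three
integer squares. -/
theorem Padic.eq_neg_sq_or_eq_sq_mul (d : ℚ_[2]) (hd : d ≠ 0) :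
    (∃ s, d = -s ^ 2) ∨
      ∃ (s : ℚ_[2]) (x y z : ℕ), s ≠ 0 ∧ x ≠ 0 ∧ d = s ^ 2 * (x ^ 2 + y ^ 2 + z ^ 2) := by
  obtain ⟨k, e, he, u, hu, rfl⟩ : ∃ (k : ℤ) (e : ℕ), e < 2 ∧ ∃ u : ℤ_[2], ‖u‖ = 1 ∧
      d = (2 ^ k) ^ 2 * (2 ^ e * u) := by
    set v := d.valuation
    have h2 : (2 : ℚ_[2]) ≠ 0 := two_ne_zero
    have hn : ‖d * 2 ^ (-v)‖ = 1 := by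
      have hp : ‖(2 : ℚ_[2])‖ = 2⁻¹ := by simpa using Padic.norm_p (p := 2)
      rw [norm_mul, norm_zpow, hp, Padic.norm_eq_zpow_neg_valuation hd]
      simp only [Nat.cast_ofNat, v, inv_zpow', neg_neg]
      rw [← zpow_add₀ (by norm_num)]
      simp
    refine ⟨v / 2, (v % 2).toNat, by omega, ⟨d * 2 ^ (-v), hn.le⟩, hn, ?_⟩
    have hv : (2 : ℚ_[2]) ^ v = (2 ^ (v / 2)) ^ 2 * 2 ^ (v % 2).toNat := by
      rw [← zpow_natCast, ← zpow_natCast, ← zpow_mul, ← zpow_add₀ h2]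
      congr 1
      omega
    change d = (2 ^ (v / 2)) ^ 2 * (2 ^ (v % 2).toNat * (d * 2 ^ (-v)))
    rw [← mul_assoc, ← hv, mul_left_comm, ← zpow_add₀ h2]
    simp
  have h2k : (2 : ℚ_[2]) ^ k ≠ 0 := zpow_ne_zero _ two_ne_zero
  obtain ⟨t, ht⟩ := PadicInt.exists_odd_eq_mul_sq u hu
  have ht0 : (t : ℚ_[2]) ≠ 0 := by
    intro h0
    rw [PadicInt.coe_eq_zero] at h0
    rcases ht with h | h | h | h <;> simp [h, h0] at hu
  have ht' : (u : ℚ_[2]) = (t : ℚ_[2]) ^ 2 ∨ (u : ℚ_[2]) = 3 * (t : ℚ_[2]) ^ 2 ∨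
      (u : ℚ_[2]) = 5 * (t : ℚ_[2]) ^ 2 ∨ (u : ℚ_[2]) = -(t : ℚ_[2]) ^ 2 := by
    rcases ht with h | h | h | h
    · left; rw [h]; push_cast; rfl
    · right; left; rw [h]; push_cast; rfl
    · right; right; left; rw [h]; push_cast; rfl
    · right; right; right; rw [h]; push_cast; rfl
  have hst : (2 : ℚ_[2]) ^ k * t ≠ 0 := mul_ne_zero h2k ht0
  interval_cases e
  · rcases ht' with h | h | h | h
    · exact Or.inr ⟨_, 1, 0, 0, hst, by decide, by rw [h]; push_cast; ring⟩
    · exact Or.inr ⟨_, 1, 1, 1, hst, by decide, by rw [h]; push_cast; ring⟩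
    · exact Or.inr ⟨_, 2, 1, 0, hst, by decide, by rw [h]; push_cast; ring⟩
    · exact Or.inl ⟨2 ^ k * t, by rw [h]; ring⟩
  · rcases ht' with h | h | h | h
    · exact Or.inr ⟨_, 1, 1, 0, hst, by decide, by rw [h]; push_cast; ring⟩
    · exact Or.inr ⟨_, 2, 1, 1, hst, by decide, by rw [h]; push_cast; ring⟩
    · exact Or.inr ⟨_, 3, 1, 0, hst, by decide, by rw [h]; push_cast; ring⟩
    -- The class of `-2` is that of `14 = 9 + 4 + 1`, since `-1 ≡ 7` modulo 8.
    · have h14 : ∃ r : ℤ_[2], (-1 : ℤ_[2]) = 7 * r ^ 2 := by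
        apply PadicInt.exists_eq_mul_sq
        · refine le_antisymm (PadicInt.norm_le_one _) (not_lt.1 fun h => ?_)
          have := (PadicInt.norm_int_lt_one_iff_dvd (p := 2) 7).1 (by exact_mod_cast h)
          omega
        · have := PadicInt.norm_p_pow (p := 2) 3
          rw [show (-1 - 7 : ℤ_[2]) = -(2 ^ 3) by norm_num, norm_neg]
          norm_num at this ⊢
          rw [this]
      obtain ⟨r, hr⟩ := h14
      have hr' : (-1 : ℚ_[2]) = 7 * (r : ℚ_[2]) ^ 2 := by
        have := congrArg (fun x : ℤ_[2] => (x : ℚ_[2])) hr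
        push_cast at this
        exact this
      have hr0 : (r : ℚ_[2]) ≠ 0 := fun h0 => by simp [h0] at hr'
      exact Or.inr ⟨_, 3, 2, 1, mul_ne_zero hst hr0, by decide, by
        rw [h]; push_cast; linear_combination 2 * (2 ^ k) ^ 2 * (t : ℚ_[2]) ^ 2 * hr'⟩

/-- Write the quadratic subfield as `ℚ_2(δ)` with `δ² = d` not a square. Then `-d = s²(x² + y² +
z²)`, so `-1` is the quotient of `(sy)² + (sz)²` by `δ² + (sx)²`, and the two-squares identity
finishes. -/
theorem exists_sq_add_sq_of_quadratic {E : Type*} [Field E] [CharZero E] [Algebra ℚ_[2] E]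
    (h : ∃ F : IntermediateField ℚ_[2] E, Module.finrank ℚ_[2] F = 2) :
    ∃ a b : E, a ^ 2 + b ^ 2 = -1 := by
  obtain ⟨δ, d, hd, hδ⟩ : ∃ (δ : E) (d : ℚ_[2]), ¬ IsSquare d ∧ δ ^ 2 = algebraMap ℚ_[2] E d := by
    obtain ⟨F, hF⟩ := h
    have : FiniteDimensional ℚ_[2] F := Module.finite_of_finrank_pos (by omega)
    obtain ⟨x, hx⟩ : ∃ x : F, x ∉ Set.range (algebraMap ℚ_[2] F) := by
      by_contra! hall
      have h1 : (⊤ : Subalgebra ℚ_[2] F) ≤ ⊥ := fun y _ => Algebra.mem_bot.2 (hall y)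
      have := Subalgebra.bot_eq_top_iff_finrank_eq_one.1 (le_antisymm bot_le h1)
      omega
    have hli : ¬ LinearIndependent ℚ_[2] ![(1 : F), x, x ^ 2] := fun hl => by
      have := hl.fintype_card_le_finrank
      simp [hF] at this
    rw [Fintype.not_linearIndependent_iff] at hli
    obtain ⟨g, hg, i, hi⟩ := hli
    simp only [Fin.sum_univ_three, Matrix.cons_val] at hg
    simp only [Algebra.smul_def] at hg
    have hg2 : g 2 ≠ 0 := by
      intro h2
      by_cases h1 : g 1 = 0
      · have h0 : g 0 = 0 := by simpa [h1, h2] using hg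
        fin_cases i <;> simp_all
      · refine hx ⟨-(g 0) / g 1, ?_⟩
        have h1' : algebraMap ℚ_[2] F (g 1) ≠ 0 := by simpa using h1
        rw [map_div₀, map_neg, div_eq_iff h1']
        rw [h2, map_zero] at hg
        linear_combination -hg
    -- Completing the square: `δ` is the derivative of the quadratic relation at `x`, and `d` its
    -- discriminant.
    refine ⟨((2 * algebraMap ℚ_[2] F (g 2) * x + algebraMap ℚ_[2] F (g 1) : F) : E),
      g 1 ^ 2 - 4 * g 2 * g 0, ?_, ?_⟩
    · rintro ⟨s, hs⟩
      have h2 : (algebraMap ℚ_[2] F (2 * g 2)) ≠ 0 := by simpa using hg2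
      have hprod : (2 * algebraMap ℚ_[2] F (g 2) * x + algebraMap ℚ_[2] F (g 1) -
          algebraMap ℚ_[2] F s) * (2 * algebraMap ℚ_[2] F (g 2) * x + algebraMap ℚ_[2] F (g 1) +
          algebraMap ℚ_[2] F s) = 0 := by
        have hs' := congrArg (algebraMap ℚ_[2] F) hs
        simp only [map_sub, map_mul, map_pow, map_ofNat] at hs'
        linear_combination hs' + 4 * algebraMap ℚ_[2] F (g 2) * hg
      rcases mul_eq_zero.1 hprod with h0 | h0
      · refine hx ⟨(s - g 1) / (2 * g 2), ?_⟩
        rw [map_div₀, div_eq_iff h2, map_sub, map_mul, map_ofNat]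
        linear_combination -h0
      · refine hx ⟨(-s - g 1) / (2 * g 2), ?_⟩
        rw [map_div₀, div_eq_iff h2, map_sub, map_mul, map_neg, map_ofNat]
        linear_combination -h0
    · rw [IsScalarTower.algebraMap_apply ℚ_[2] F E]
      rw [show ((2 * algebraMap ℚ_[2] F (g 2) * x + algebraMap ℚ_[2] F (g 1) : F) : E) =
        algebraMap F E (2 * algebraMap ℚ_[2] F (g 2) * x + algebraMap ℚ_[2] F (g 1)) from rfl,
        ← map_pow]
      congr 1
      simp only [map_sub, map_mul, map_pow, map_ofNat]
      linear_combination 4 * algebraMap ℚ_[2] F (g 2) * hg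
  have hd0 : d ≠ 0 := fun h0 => hd ⟨0, by simp [h0]⟩
  rcases Padic.eq_neg_sq_or_eq_sq_mul (-d) (neg_ne_zero.2 hd0) with ⟨s, hs⟩ |
    ⟨s, x, y, z, hs, hx, hxyz⟩
  · exact absurd ⟨s, by rw [← sq]; exact neg_injective hs⟩ hd
  · set σ := algebraMap ℚ_[2] E s with hσ
    have hσ0 : σ ≠ 0 := by simpa [hσ] using hs
    have hx0 : (x : E) ≠ 0 := Nat.cast_ne_zero.2 hx
    have h1 : δ ^ 2 = - (σ ^ 2 * (x ^ 2 + y ^ 2 + z ^ 2)) := by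
      have := congrArg (algebraMap ℚ_[2] E) hxyz
      simp only [map_neg, map_mul, map_pow, map_add, map_natCast, ← hδ, ← hσ] at this
      linear_combination -this
    by_cases h0 : δ ^ 2 + (σ * x) ^ 2 = 0
    -- When the denominator vanishes, `-1` is itself a square; this is where `x ≠ 0` is needed.
    · refine ⟨δ / (σ * x), 0, ?_⟩
      field_simp
      linear_combination h0
    · refine ⟨(σ * y * δ + σ * z * (σ * x)) / (δ ^ 2 + (σ * x) ^ 2),
        (σ * y * (σ * x) - σ * z * δ) / (δ ^ 2 + (σ * x) ^ 2), ?_⟩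
      rw [div_pow, div_pow, ← add_div, div_eq_iff (pow_ne_zero 2 h0)]
      linear_combination (δ ^ 2 + (σ * x) ^ 2) * h1

/-! ### Generators of the Hurwitz group -/

section HurwitzGenerators

/-- `𝐰` as an element of the Hurwitz group. -/
def genW : hurwitzGroup := ⟨hurwitzW, Subgroup.subset_closure (by simp)⟩

/-- `𝐮` as an element of the Hurwitz group. -/
def genU : hurwitzGroup := ⟨hurwitzU, Subgroup.subset_closure (by simp)⟩

/-- `𝐯` as an element of the Hurwitz group. -/
def genV : hurwitzGroup := ⟨hurwitzV, Subgroup.subset_closure (by simp)⟩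

theorem val_genW : (genW.1.1 : ℍ[ℚ]).re = -1 / 2 ∧ (genW.1.1 : ℍ[ℚ]).imI = 1 / 2 ∧
    (genW.1.1 : ℍ[ℚ]).imJ = 1 / 2 ∧ (genW.1.1 : ℍ[ℚ]).imK = 1 / 2 := ⟨rfl, rfl, rfl, rfl⟩

theorem val_genU : (genU.1.1 : ℍ[ℚ]).re = 0 ∧ (genU.1.1 : ℍ[ℚ]).imI = 1 ∧
    (genU.1.1 : ℍ[ℚ]).imJ = 0 ∧ (genU.1.1 : ℍ[ℚ]).imK = 0 := ⟨rfl, rfl, rfl, rfl⟩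

theorem val_genV : (genV.1.1 : ℍ[ℚ]).re = 0 ∧ (genV.1.1 : ℍ[ℚ]).imI = 0 ∧
    (genV.1.1 : ℍ[ℚ]).imJ = 1 ∧ (genV.1.1 : ℍ[ℚ]).imK = 0 := ⟨rfl, rfl, rfl, rfl⟩

theorem genW_mul_genV : genW * genV = genU * genW := by
  apply Subtype.ext
  apply Units.ext
  change genW.1.1 * genV.1.1 = genU.1.1 * genW.1.1
  ext <;> norm_num [val_genW, val_genU, val_genV]

/-- Conjugation by `𝐰` carries `𝐯` to `𝐮`, so `𝐯` is redundant and only two matrices need tracking.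
-/
theorem closure_genW_genU : Subgroup.closure {genW, genU} = ⊤ := by
  rw [eq_top_iff]
  have h := Subgroup.closure_closure_coe_preimage (k := {hurwitzW, hurwitzU, hurwitzV})
  refine (le_of_eq h.symm).trans ((Subgroup.closure_le _).2 ?_)
  have hW : genW ∈ Subgroup.closure {genW, genU} := Subgroup.subset_closure (by simp)
  have hU : genU ∈ Subgroup.closure {genW, genU} := Subgroup.subset_closure (by simp)
  rintro ⟨x, hx⟩ (rfl | rfl | rfl)
  · exact hW
  · exact hU
  · change genV ∈ Subgroup.closure {genW, genU}
    rw [eq_inv_mul_of_mul_eq genW_mul_genV]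
    exact mul_mem (inv_mem hW) (mul_mem hU hW)

theorem hurwitzGroup_hom_ext {H : Type*} [Group H] {φ ψ : hurwitzGroup →* H}
    (hw : φ genW = ψ genW) (hu : φ genU = ψ genU) : φ = ψ :=
  MonoidHom.eq_of_eqOn_dense closure_genW_genU (by
    rintro x (rfl | rfl)
    · exact hw
    · exact hu)

end HurwitzGenerators

/-! ### Two-by-two matrices -/

section TwoByTwo

/-- A nonscalar matrix satisfies only one monic quadratic equation, the Cayley–Hamilton one; failing
to commute with `Y` rules out scalars. -/
theorem Matrix.trace_det_of_quadratic {E : Type*} [Field E] {X Y : Matrix (Fin 2) (Fin 2) E}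
    {t n : E} (hX : X * X = t • X - n • (1 : Matrix (Fin 2) (Fin 2) E)) (hXY : X * Y ≠ Y * X) :
    X.trace = t ∧ X.det = n := by
  have h : (X.trace - t) • X = (X.det - n) • (1 : Matrix (Fin 2) (Fin 2) E) := by
    have h1 : X * X = X.trace • X - X.det • (1 : Matrix (Fin 2) (Fin 2) E) := by
      ext i j
      fin_cases i <;> fin_cases j <;>
        simp [Matrix.mul_apply, Matrix.trace_fin_two, Matrix.det_fin_two, Fin.sum_univ_two] <;> ring
    rw [sub_smul, sub_smul, sub_eq_sub_iff_add_eq_add, add_comm (X.det • 1), ← sub_eq_sub_iff_add_eq_add,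
      ← h1, hX]
  have ht : X.trace = t := by
    by_contra hne
    have hne' := sub_ne_zero.2 hne
    apply hXY
    have h2 : X = ((X.trace - t)⁻¹ * (X.det - n)) • (1 : Matrix (Fin 2) (Fin 2) E) := by
      rw [mul_smul, ← h, smul_smul, inv_mul_cancel₀ hne', one_smul]
    rw [h2]
    simp
  refine ⟨ht, ?_⟩
  rw [ht, sub_self, zero_smul] at h
  have := congrFun (congrFun h 0) 0
  simp at this
  exact (sub_eq_zero.1 this.symm)

theorem Matrix.exists_GL_val_eq {R : Type*} [CommRing R] (A : Matrix (Fin 2) (Fin 2) R)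
    (h : IsUnit A.det) : ∃ g : GL (Fin 2) R, g.val = A :=
  ⟨Matrix.GeneralLinearGroup.mk'' A h, rfl⟩

/-- Idempotents of rank one over a local ring can be diagonalised. -/
theorem Matrix.exists_diagonalize_idempotent {R : Type*} [CommRing R] [IsLocalRing R]
    (e : Matrix (Fin 2) (Fin 2) R) (ht : e 0 0 + e 1 1 = 1)
    (hd : e 0 0 * e 1 1 - e 0 1 * e 1 0 = 0) :
    ∃ h : GL (Fin 2) R, e * h.val = h.val * !![1, 0; 0, 0] := by
  rcases IsLocalRing.isUnit_or_isUnit_of_add_one ht with hu | hu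
  · obtain ⟨h, hh⟩ := Matrix.exists_GL_val_eq !![e 0 0, -e 0 1; e 1 0, e 0 0] (by
      rw [Matrix.det_fin_two_of]
      convert hu using 1
      linear_combination -hd + e 0 0 * ht)
    refine ⟨h, ?_⟩
    rw [hh]
    ext i j
    fin_cases i <;> fin_cases j <;> simp [Matrix.mul_apply, Fin.sum_univ_two]
    · linear_combination -hd + e 0 0 * ht
    · ring
    · linear_combination e 1 0 * ht
    · linear_combination hd
  · obtain ⟨h, hh⟩ := Matrix.exists_GL_val_eq !![e 0 1, e 1 1; e 1 1, -e 1 0] (by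
      rw [Matrix.det_fin_two_of]
      convert hu.neg using 1
      linear_combination hd - e 1 1 * ht)
    refine ⟨h, ?_⟩
    rw [hh]
    ext i j
    fin_cases i <;> fin_cases j <;> simp [Matrix.mul_apply, Fin.sum_univ_two]
    · linear_combination e 0 1 * ht
    · linear_combination hd
    · linear_combination -hd + e 1 1 * ht
    · ring

end TwoByTwo

/-! ### Integral forms: conjugation, invariants and descent -/

namespace IntegralRep

section General

variable {R K : Type*} [CommRing R] [Field K] [Algebra R K] {G : Type*} [Group G] {n : ℕ}
  {ρ : G →* GL (Fin n) K}

/-- The conjugate of an integral representation by an element of `GL_n(R)`. -/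
def conj (ρ' : IntegralRep R ρ) (h : GL (Fin n) R) : IntegralRep R ρ :=
  ⟨(MulAut.conj h⁻¹).toMonoidHom.comp ρ'.1, by
    obtain ⟨g, hg⟩ := ρ'.2
    refine ⟨(Matrix.GeneralLinearGroup.map (algebraMap R K) h)⁻¹ * g, fun x => ?_⟩
    change Matrix.GeneralLinearGroup.map (algebraMap R K) (h⁻¹ * ρ'.1 x * h⁻¹⁻¹) = _
    rw [inv_inv, map_mul, map_mul, map_inv, hg]
    group⟩

theorem conj_equiv (ρ' : IntegralRep R ρ) (h : GL (Fin n) R) :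
    integralRepSetoid R ρ ρ' (ρ'.conj h) :=
  ⟨h⁻¹, fun _ => by simp [conj]⟩

theorem conj_val_eq (ρ' : IntegralRep R ρ) (h : GL (Fin n) R) {x : G}
    {D : Matrix (Fin n) (Fin n) R} (hx : (ρ'.1 x).val * h.val = h.val * D) :
    ((ρ'.conj h).1 x).val = D := by
  change (h⁻¹ * ρ'.1 x * h⁻¹⁻¹ : GL (Fin n) R).val = D
  rw [inv_inv, mul_assoc, Units.val_mul, Units.val_mul, hx, ← mul_assoc, Units.inv_mul, one_mul]

theorem exists_conj_field (ρ₁ ρ₂ : IntegralRep R ρ) : ∃ z : GL (Fin n) K, ∀ x,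
    (ρ₂.1 x).val.map (algebraMap R K) * z.val = z.val * (ρ₁.1 x).val.map (algebraMap R K) := by
  obtain ⟨g₁, h₁⟩ := ρ₁.2
  obtain ⟨g₂, h₂⟩ := ρ₂.2
  refine ⟨g₂ * g₁⁻¹, fun x => ?_⟩
  have h : Matrix.GeneralLinearGroup.map (algebraMap R K) (ρ₂.1 x) * (g₂ * g₁⁻¹) =
      (g₂ * g₁⁻¹) * Matrix.GeneralLinearGroup.map (algebraMap R K) (ρ₁.1 x) := by
    rw [h₁, h₂]; group
  exact congrArg Units.val h

/-- A representation over the field, as an integral form of itself. -/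
def self (ρ : G →* GL (Fin n) K) : IntegralRep K ρ :=
  ⟨ρ, 1, fun x => by
    rw [one_mul, inv_one, mul_one]
    ext i j
    rfl⟩

end General

variable {R E : Type*} [CommRing R] [Field E] [CharZero E] [Algebra R E] {f : HamiltonSplitting E}

theorem equiv_of_gens {ρ₁ ρ₂ : IntegralRep R (hurwitzRep f)} (h : GL (Fin 2) R)
    (hw : (ρ₂.1 genW).val * h.val = h.val * (ρ₁.1 genW).val)
    (hu : (ρ₂.1 genU).val * h.val = h.val * (ρ₁.1 genU).val) :
    integralRepSetoid R (hurwitzRep f) ρ₁ ρ₂ := by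
  refine ⟨h, fun x => ?_⟩
  have key : ρ₂.1 = (MulAut.conj h).toMonoidHom.comp ρ₁.1 := by
    apply hurwitzGroup_hom_ext
    · exact eq_mul_inv_of_mul_eq (Units.ext hw)
    · exact eq_mul_inv_of_mul_eq (Units.ext hu)
  rw [key]
  rfl

/-- A conjugate of the splitting extends the representation to the whole quaternion algebra, so
additive identities between quaternions pass to matrices. -/
theorem exists_ringHom (ρ' : IntegralRep R (hurwitzRep f)) :
    ∃ F : ℍ[ℚ] →+* Matrix (Fin 2) (Fin 2) E, ∀ x : hurwitzGroup,
      (ρ'.1 x).val.map (algebraMap R E) = F x.1.1 := by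
  obtain ⟨g, hg⟩ := ρ'.2
  let F₀ : ℍ[ℚ] →+* Matrix (Fin 2) (Fin 2) E := f.toAlgHom.toRingHom.comp
    (Algebra.TensorProduct.includeRight : ℍ[ℚ] →ₐ[ℚ] E ⊗[ℚ] ℍ[ℚ]).toRingHom
  refine ⟨{ toFun := fun q => g.val * F₀ q * (g⁻¹).val
            map_one' := by rw [map_one, mul_one, Units.mul_inv]
            map_zero' := by rw [map_zero, mul_zero, zero_mul]
            map_add' := fun x y => by rw [map_add, mul_add, add_mul]
            map_mul' := fun x y => by
              rw [map_mul]
              simp only [mul_assoc, Units.inv_mul_cancel_left] }, fun x => ?_⟩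
  exact congrArg Units.val (hg x)

variable (hinj : Function.Injective (algebraMap R E))
include hinj

/-- A noncentral quaternion has a nonscalar image, whose trace and determinant are therefore
dictated by its quadratic equation, whatever the splitting. -/
theorem trace_det (ρ' : IntegralRep R (hurwitzRep f)) (x : hurwitzGroup) (t n : ℤ)
    (hx : (x.1.1 * x.1.1 : ℍ[ℚ]) = t * x.1.1 - n)
    (hy : ∃ y : ℍ[ℚ], x.1.1 * y ≠ y * x.1.1) :
    (ρ'.1 x).val.trace = t ∧ (ρ'.1 x).val.det = n := by
  obtain ⟨F, hF⟩ := ρ'.exists_ringHom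
  obtain ⟨y, hy⟩ := hy
  have h := Matrix.trace_det_of_quadratic (X := F x.1.1) (Y := F y) (t := t) (n := n) (by
    rw [← map_mul, hx, map_sub, map_mul, map_intCast, map_intCast]
    rw [← zsmul_eq_mul, Int.cast_smul_eq_zsmul, Int.cast_smul_eq_zsmul, zsmul_one]) (by
    rw [← map_mul, ← map_mul]
    exact fun h => hy (F.injective h))
  rw [← hF] at h
  constructor
  · apply hinj
    rw [map_intCast, ← h.1, Matrix.trace_fin_two, Matrix.trace_fin_two, map_add]
    rfl
  · apply hinj
    rw [map_intCast, ← h.2, ← RingHom.mapMatrix_apply, RingHom.map_det]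

theorem trace_det_genW (ρ' : IntegralRep R (hurwitzRep f)) :
    (ρ'.1 genW).val 0 0 + (ρ'.1 genW).val 1 1 = -1 ∧
    (ρ'.1 genW).val 0 0 * (ρ'.1 genW).val 1 1 - (ρ'.1 genW).val 0 1 * (ρ'.1 genW).val 1 0 = 1 := by
  have h := trace_det hinj ρ' genW (-1) 1 (by ext <;> norm_num [val_genW])
    ⟨genU.1.1, fun h => by
      have := congrArg QuaternionAlgebra.imJ h
      norm_num [val_genW, val_genU] at this⟩
  rw [Matrix.trace_fin_two, Matrix.det_fin_two] at h
  simpa using h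

theorem trace_det_genU (ρ' : IntegralRep R (hurwitzRep f)) :
    (ρ'.1 genU).val 0 0 + (ρ'.1 genU).val 1 1 = 0 ∧
    (ρ'.1 genU).val 0 0 * (ρ'.1 genU).val 1 1 - (ρ'.1 genU).val 0 1 * (ρ'.1 genU).val 1 0 = 1 := by
  have h := trace_det hinj ρ' genU 0 1 (by ext <;> norm_num [val_genU])
    ⟨genV.1.1, fun h => by
      have := congrArg QuaternionAlgebra.imK h
      norm_num [val_genU, val_genV] at this⟩
  rw [Matrix.trace_fin_two, Matrix.det_fin_two] at h
  simpa using h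

theorem trace_det_genV (ρ' : IntegralRep R (hurwitzRep f)) :
    (ρ'.1 genV).val 0 0 + (ρ'.1 genV).val 1 1 = 0 ∧
    (ρ'.1 genV).val 0 0 * (ρ'.1 genV).val 1 1 - (ρ'.1 genV).val 0 1 * (ρ'.1 genV).val 1 0 = 1 := by
  have h := trace_det hinj ρ' genV 0 1 (by ext <;> norm_num [val_genV])
    ⟨genU.1.1, fun h => by
      have := congrArg QuaternionAlgebra.imK h
      norm_num [val_genV, val_genU] at this⟩
  rw [Matrix.trace_fin_two, Matrix.det_fin_two] at h
  simpa using h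

theorem trace_genW_mul_genU (ρ' : IntegralRep R (hurwitzRep f)) :
    (ρ'.1 genW).val 0 0 * (ρ'.1 genU).val 0 0 + (ρ'.1 genW).val 0 1 * (ρ'.1 genU).val 1 0 +
    ((ρ'.1 genW).val 1 0 * (ρ'.1 genU).val 0 1 + (ρ'.1 genW).val 1 1 * (ρ'.1 genU).val 1 1) = -1 := by
  have h := (trace_det hinj ρ' (genW * genU) (-1) 1
    (by ext <;> norm_num [val_genW, val_genU]) ⟨genU.1.1, fun h => by
      have := congrArg QuaternionAlgebra.imJ h
      rw [Quaternion.imJ_mul, Quaternion.imJ_mul] at this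
      norm_num [val_genW, val_genU] at this⟩).1
  rw [map_mul, Units.val_mul, Matrix.trace_fin_two, Matrix.mul_apply, Matrix.mul_apply,
    Fin.sum_univ_two, Fin.sum_univ_two] at h
  simpa using h

theorem trace_genU_mul_genV (ρ' : IntegralRep R (hurwitzRep f)) :
    (ρ'.1 genU).val 0 0 * (ρ'.1 genV).val 0 0 + (ρ'.1 genU).val 0 1 * (ρ'.1 genV).val 1 0 +
    ((ρ'.1 genU).val 1 0 * (ρ'.1 genV).val 0 1 + (ρ'.1 genU).val 1 1 * (ρ'.1 genV).val 1 1) = 0 := by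
  have h := (trace_det hinj ρ' (genU * genV) 0 1
    (by ext <;> norm_num [val_genU, val_genV]) ⟨genU.1.1, fun h => by
      have := congrArg QuaternionAlgebra.imJ h
      rw [Quaternion.imJ_mul, Quaternion.imJ_mul] at this
      norm_num [val_genU, val_genV] at this⟩).1
  rw [map_mul, Units.val_mul, Matrix.trace_fin_two, Matrix.mul_apply, Matrix.mul_apply,
    Fin.sum_univ_two, Fin.sum_univ_two] at h
  simpa using h

theorem two_mul_genW (ρ' : IntegralRep R (hurwitzRep f)) :
    (2 : R) • (ρ'.1 genW).val =
      -1 + (ρ'.1 genU).val + (ρ'.1 genV).val + (ρ'.1 genU).val * (ρ'.1 genV).val := by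
  obtain ⟨F, hF⟩ := ρ'.exists_ringHom
  have hq : (2 : ℍ[ℚ]) * genW.1.1 = -1 + genU.1.1 + genV.1.1 + genU.1.1 * genV.1.1 := by
    rw [two_mul]
    ext <;> norm_num [val_genW, val_genU, val_genV]
  have h := congrArg F hq
  simp only [map_mul, map_add, map_neg, map_one, ← hF, map_ofNat] at h
  apply Matrix.map_injective hinj
  simp only [← RingHom.mapMatrix_apply] at h ⊢
  rw [map_add, map_add, map_add, map_neg, map_one, map_mul, ← h]
  ext i j
  simp [two_mul]

/-- Integral matrices generating a field representation of the Hurwitz group give an integral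
representation. -/
theorem exists_of_gens (ρE : IntegralRep E (hurwitzRep f)) (W U : Matrix (Fin 2) (Fin 2) R)
    (hW : W.map (algebraMap R E) = (ρE.1 genW).val)
    (hU : U.map (algebraMap R E) = (ρE.1 genU).val) :
    ∃ ρ' : IntegralRep R (hurwitzRep f), (ρ'.1 genW).val = W ∧ (ρ'.1 genU).val = U := by
  have hdet : ∀ (A : Matrix (Fin 2) (Fin 2) R), (A.map (algebraMap R E)).det = 1 → IsUnit A.det := by
    intro A hA
    rw [← RingHom.mapMatrix_apply, ← RingHom.map_det, ← map_one (algebraMap R E)] at hA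
    rw [hinj hA]
    exact isUnit_one
  obtain ⟨w, hw⟩ := Matrix.exists_GL_val_eq W (hdet W (by
    rw [hW, Matrix.det_fin_two]; exact (trace_det_genW Function.injective_id ρE).2))
  obtain ⟨u, hu⟩ := Matrix.exists_GL_val_eq U (hdet U (by
    rw [hU, Matrix.det_fin_two]; exact (trace_det_genU Function.injective_id ρE).2))
  let ι : GL (Fin 2) R →* GL (Fin 2) E := Matrix.GeneralLinearGroup.map (algebraMap R E)
  have hι : Function.Injective ι := fun a b hab =>
    Units.ext (Matrix.map_injective hinj (congrArg Units.val hab))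
  have hιw : ι w = ρE.1 genW := Units.ext (by rw [← hW, ← hw]; rfl)
  have hιu : ι u = ρE.1 genU := Units.ext (by rw [← hU, ← hu]; rfl)
  -- It suffices that the generators lie in the image of `GL₂(R)`, a subgroup onto which `ι` is an
  -- isomorphism.
  have hr : ∀ x, ρE.1 x ∈ ι.range := by
    have : (⊤ : Subgroup hurwitzGroup) ≤ ι.range.comap ρE.1 := by
      rw [← closure_genW_genU, Subgroup.closure_le]
      rintro x (rfl | rfl)
      · exact ⟨w, hιw⟩
      · exact ⟨u, hιu⟩
    exact fun x => this (Subgroup.mem_top x)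
  let φ : hurwitzGroup →* GL (Fin 2) R :=
    (MonoidHom.ofInjective hι).symm.toMonoidHom.comp (ρE.1.codRestrict ι.range hr)
  have hφ : ∀ x, ι (φ x) = ρE.1 x := fun x => by
    have := (MonoidHom.ofInjective hι).apply_symm_apply ⟨ρE.1 x, hr x⟩
    exact congrArg Subtype.val this
  obtain ⟨g, hg⟩ := ρE.2
  refine ⟨⟨φ, g, fun x => ?_⟩, ?_, ?_⟩
  · rw [← hg]
    refine (hφ x).trans ?_
    ext i j
    rfl
  · rw [← hw]
    exact congrArg Units.val (hι ((hφ _).trans hιw.symm))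
  · rw [← hu]
    exact congrArg Units.val (hι ((hφ _).trans hιu.symm))

end IntegralRep

namespace IntegralRep

variable {R E : Type*} [CommRing R] [Field E] [CharZero E] [Algebra R E] {f : HamiltonSplitting E}

/-! ### No cube root of unity: companion form -/

section Companion

/-- If `X² + X + 1` has no root modulo any maximal ideal, `𝐰` can be put in companion form. -/
theorem exists_companion_form (hinj : Function.Injective (algebraMap R E))
    (hR : ∀ x : R, IsUnit (x ^ 2 + x + 1)) (ρ' : IntegralRep R (hurwitzRep f)) :
    ∃ ρ'' : IntegralRep R (hurwitzRep f), integralRepSetoid R (hurwitzRep f) ρ' ρ'' ∧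
      (ρ''.1 genW).val = !![0, -1; 1, -1] := by
  obtain ⟨ht, hd⟩ := trace_det_genW hinj ρ'
  set X := (ρ'.1 genW).val with hX
  have hz : IsUnit (X 1 0) := by
    have := hR (X 0 0)
    rw [show X 0 0 ^ 2 + X 0 0 + 1 = X 1 0 * (- X 0 1) by linear_combination X 0 0 * ht - hd] at this
    exact isUnit_of_mul_isUnit_left this
  -- The basis `e₁, We₁`: the first basis vector is cyclic because `X² + X + 1` at the corner entry
  -- is a multiple of `X 1 0`.
  obtain ⟨h, hh⟩ := Matrix.exists_GL_val_eq !![1, X 0 0; 0, X 1 0] (by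
    rw [Matrix.det_fin_two_of]; simpa using hz)
  refine ⟨ρ'.conj h, ρ'.conj_equiv h, ρ'.conj_val_eq h ?_⟩
  rw [hh, ← hX]
  ext i j
  fin_cases i <;> fin_cases j <;> simp [Matrix.mul_apply, Fin.sum_univ_two]
  · linear_combination X 0 0 * ht - hd
  · linear_combination X 1 0 * ht

/-- The conditions `tr U = 0` and `tr WU = -1` leave two parameters. The determinant condition is a
conic centred at `(1/3, 2/3)`, here recentred and multiplied by `9`. -/
theorem genU_of_companion (hinj : Function.Injective (algebraMap R E))
    (ρ' : IntegralRep R (hurwitzRep f)) (hW : (ρ'.1 genW).val = !![0, -1; 1, -1]) :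
    ∃ p r : R, (ρ'.1 genU).val = !![p, r - p - 1; r, -p] ∧
      (3 * p - 1) ^ 2 - (3 * p - 1) * (3 * r - 2) + (3 * r - 2) ^ 2 = -6 := by
  obtain ⟨ht, hd⟩ := trace_det_genU hinj ρ'
  have hwu := trace_genW_mul_genU hinj ρ'
  rw [hW] at hwu
  set U := (ρ'.1 genU).val
  simp at hwu
  have h11 : U 1 1 = - U 0 0 := by linear_combination ht
  have h01 : U 0 1 = U 1 0 - U 0 0 - 1 := by linear_combination hwu + ht
  refine ⟨U 0 0, U 1 0, ?_, ?_⟩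
  · ext i j
    fin_cases i <;> fin_cases j <;> simp [h11, h01]
  · rw [h11, h01] at hd
    linear_combination -9 * hd

-- For `|x| ≤ |y|` and `y ≠ 0` the form is `y²` times the value of `X² + X + 1` at the integer
-- `-x/y`, which is a unit by assumption.
omit [CharZero E] in
theorem abs_normForm {N : AbsoluteValue E ℝ} (hω : ∀ x, N x ≤ 1 → N (x ^ 2 + x + 1) = 1) (x y : E) :
    N (x ^ 2 - x * y + y ^ 2) = max (N x) (N y) ^ 2 := by
  have key : ∀ x y : E, N x ≤ N y → N (x ^ 2 - x * y + y ^ 2) = N y ^ 2 := by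
    intro x y hxy
    by_cases hy : y = 0
    · subst hy
      have : x = 0 := by simpa using hxy
      simp [this]
    · have h := hω (-(x / y)) (by
        rw [map_neg_eq_map, map_div₀]
        exact div_le_one_of_le₀ hxy (N.nonneg _))
      rw [show x ^ 2 - x * y + y ^ 2 = ((-(x / y)) ^ 2 + -(x / y) + 1) * y ^ 2 by field_simp; ring,
        map_mul, h, one_mul, map_pow]
  rcases le_total (N x) (N y) with h | h
  · rw [key x y h, max_eq_right h]
  · rw [show x ^ 2 - x * y + y ^ 2 = y ^ 2 - y * x + x ^ 2 by ring, key y x h, max_eq_left h]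

omit [CharZero E] in
theorem card_integralForms_eq_one {ρ : hurwitzGroup →* GL (Fin 2) E} (hne : Nonempty (IntegralRep R ρ))
    (h : ∀ ρ₁ ρ₂ : IntegralRep R ρ, integralRepSetoid R ρ ρ₁ ρ₂) :
    ENat.card (IntegralForms R ρ) = 1 := by
  have h1 : Subsingleton (IntegralForms R ρ) := ⟨by
    rintro ⟨a⟩ ⟨b⟩
    exact Quotient.sound (h a b)⟩
  have h2 : Nonempty (IntegralForms R ρ) := hne.map fun a => Quotient.mk (integralRepSetoid R ρ) a
  exact le_antisymm (ENat.card_le_one_iff_subsingleton _ |>.2 h1)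
    (ENat.one_le_card_iff_nonempty _ |>.2 h2)

/-- If the residue field has no primitive cube root of unity and `3` is invertible, there is exactly
one integral form. -/
theorem card_integralForms_of_no_cubeRoot {N : AbsoluteValue E ℝ}
    (hN : ∀ x y, N (x + y) ≤ max (N x) (N y)) (hinj : Function.Injective (algebraMap R E))
    (hR : ∀ x, N x ≤ 1 ↔ x ∈ Set.range (algebraMap R E)) (h3 : N 3 = 1)
    (hω : ∀ x, N x ≤ 1 → N (x ^ 2 + x + 1) = 1) (hω' : ∀ x : E, x ^ 2 + x + 1 ≠ 0) :
    ENat.card (IntegralForms R (hurwitzRep f)) = 1 := by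
  have hunit : ∀ x : R, IsUnit (x ^ 2 + x + 1) := fun x => by
    rw [isUnit_iff_abs_eq_one hinj hR]
    simpa using hω _ ((hR _).2 ⟨x, rfl⟩)
  apply card_integralForms_eq_one
  · obtain ⟨ρE, -, hW⟩ := exists_companion_form (f := f) Function.injective_id
      (fun x => (hω' x).isUnit) (self (hurwitzRep f))
    obtain ⟨p, r, hU, hpr⟩ := genU_of_companion Function.injective_id ρE hW
    have h6 : max (N (3 * p - 1)) (N (3 * r - 2)) ≤ 1 := by
      have h := abs_normForm hω (3 * p - 1) (3 * r - 2)
      rw [hpr] at h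
      have h' : N (-6 : E) ≤ 1 := (hR _).2 ⟨-6, by rw [map_neg, map_ofNat]⟩
      rw [h] at h'
      exact (sq_le_one_iff₀ (le_max_of_le_left (N.nonneg _))).1 h'
    have hint : ∀ (x : E) (k : ℤ), N (3 * x - k) ≤ 1 → N x ≤ 1 := by
      intro x k hx
      have hk : N (k : E) ≤ 1 := (hR _).2 ⟨k, by simp⟩
      have := hN (3 * x - k) k
      rw [sub_add_cancel, map_mul, h3, one_mul] at this
      exact this.trans (max_le hx hk)
    obtain ⟨p', hp'⟩ := (hR p).1 (hint p 1 (by simpa using (le_max_left _ _).trans h6))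
    obtain ⟨r', hr'⟩ := (hR r).1 (hint r 2 (by simpa using (le_max_right _ _).trans h6))
    obtain ⟨ρ', -⟩ := exists_of_gens hinj ρE !![0, -1; 1, -1] !![p', r' - p' - 1; r', -p'] (by
      rw [hW]; ext i j; fin_cases i <;> fin_cases j <;> simp) (by
      rw [hU]; ext i j; fin_cases i <;> fin_cases j <;> simp [hp', hr'])
    exact ⟨ρ'⟩
  · intro ρ₁ ρ₂
    obtain ⟨σ₁, h₁, hW₁⟩ := exists_companion_form hinj hunit ρ₁
    obtain ⟨σ₂, h₂, hW₂⟩ := exists_companion_form hinj hunit ρ₂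
    refine (integralRepSetoid R _).trans' h₁ ((integralRepSetoid R _).trans' ?_
      ((integralRepSetoid R _).symm' h₂))
    obtain ⟨z, hz⟩ := exists_conj_field σ₁ σ₂
    have hzW := hz genW
    have hzU := hz genU
    rw [hW₁, hW₂] at hzW
    set a := z.val 0 0 with ha
    set b := z.val 1 0 with hb
    have h01 : z.val 0 1 = -b := by
      have := congrFun (congrFun hzW 0) 0
      simp [Matrix.mul_apply, Fin.sum_univ_two] at this
      exact this.symm
    have h11 : z.val 1 1 = a - b := by
      have := congrFun (congrFun hzW 1) 0
      simp [Matrix.mul_apply, Fin.sum_univ_two] at this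
      linear_combination -this
    -- The intertwiner commutes with the companion matrix `W`, so it is `a + bW`, with determinant
    -- `a² - ab + b²`.
    have hzval : z.val = !![a, -b; b, a - b] := by
      ext i j
      fin_cases i <;> fin_cases j <;> simp [h01, h11, ha, hb]
    -- Dividing by the larger coefficient makes the intertwiner integral with unit determinant.
    obtain ⟨m, hm, hm0⟩ : ∃ m : E, N m = max (N a) (N b) ∧ m ≠ 0 := by
      have hne : ¬ (a = 0 ∧ b = 0) := by
        rintro ⟨h0, h0'⟩
        have := z.isUnit
        rw [Matrix.isUnit_iff_isUnit_det, hzval, h0, h0'] at this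
        simp at this
      rcases le_total (N a) (N b) with h | h
      · refine ⟨b, (max_eq_right h).symm, fun h0 => hne ⟨?_, h0⟩⟩
        simpa [h0] using h
      · refine ⟨a, (max_eq_left h).symm, fun h0 => hne ⟨h0, ?_⟩⟩
        simpa [h0] using h
    have hNm : 0 < N m := N.pos hm0
    obtain ⟨a', ha'⟩ := (hR (a / m)).1 (by
      rw [map_div₀, div_le_one hNm, hm]; exact le_max_left _ _)
    obtain ⟨b', hb'⟩ := (hR (b / m)).1 (by
      rw [map_div₀, div_le_one hNm, hm]; exact le_max_right _ _)
    obtain ⟨h, hh⟩ := Matrix.exists_GL_val_eq !![a', -b'; b', a' - b'] (by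
      rw [isUnit_iff_abs_eq_one hinj hR, Matrix.det_fin_two_of,
        show a' * (a' - b') - -b' * b' = a' ^ 2 - a' * b' + b' ^ 2 by ring]
      simp only [map_add, map_sub, map_mul, map_pow, ha', hb']
      rw [abs_normForm hω, map_div₀, map_div₀, max_div_div_right hNm.le, ← hm,
        div_self hNm.ne', one_pow])
    have hmap : h.val.map (algebraMap R E) = m⁻¹ • z.val := by
      rw [hh, hzval]
      ext i j
      fin_cases i <;> fin_cases j <;> simp [ha', hb'] <;> ring
    have hlift : ∀ x, (σ₂.1 x).val.map (algebraMap R E) * z.val =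
        z.val * (σ₁.1 x).val.map (algebraMap R E) →
        (σ₂.1 x).val * h.val = h.val * (σ₁.1 x).val := by
      intro x hx
      apply Matrix.map_injective hinj
      beta_reduce
      rw [Matrix.map_mul, Matrix.map_mul, hmap, mul_smul_comm, smul_mul_assoc, hx]
    exact equiv_of_gens h (hlift _ (hz genW)) (hlift _ hzU)

end Companion

/-! ### Two invertible: a single standard form -/

section OddResidue

theorem exists_genU_genV_form (hinj : Function.Injective (algebraMap R E))
    (ρ' : IntegralRep R (hurwitzRep f)) : ∃ p q r x y z : R,
      (ρ'.1 genU).val = !![p, q; r, -p] ∧ (ρ'.1 genV).val = !![x, y; z, -x] ∧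
      p ^ 2 + q * r = -1 ∧ x ^ 2 + y * z = -1 ∧ 2 * p * x + q * z + r * y = 0 := by
  obtain ⟨htU, hdU⟩ := trace_det_genU hinj ρ'
  obtain ⟨htV, hdV⟩ := trace_det_genV hinj ρ'
  have huv := trace_genU_mul_genV hinj ρ'
  set U := (ρ'.1 genU).val
  set V := (ρ'.1 genV).val
  have hU1 : U 1 1 = - U 0 0 := by linear_combination htU
  have hV1 : V 1 1 = - V 0 0 := by linear_combination htV
  rw [hU1] at hdU huv
  rw [hV1] at hdV huv
  refine ⟨U 0 0, U 0 1, U 1 0, V 0 0, V 0 1, V 1 0, ?_, ?_, ?_, ?_, ?_⟩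
  · ext i j
    fin_cases i <;> fin_cases j <;> simp [hU1]
  · ext i j
    fin_cases i <;> fin_cases j <;> simp [hV1]
  · linear_combination -hdU
  · linear_combination -hdV
  · linear_combination huv

/-- If `2` is invertible and `-1 = a² + b²`, all integral forms are equivalent to a fixed one. -/
theorem exists_standard_form [IsLocalRing R] (hinj : Function.Injective (algebraMap R E)) {a b c : R}
    (hab : a ^ 2 + b ^ 2 = -1) (hc : 2 * c = 1) (ρ' : IntegralRep R (hurwitzRep f)) :
    ∃ ρ'' : IntegralRep R (hurwitzRep f), integralRepSetoid R (hurwitzRep f) ρ' ρ'' ∧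
      (ρ''.1 genU).val = !![0, -1; 1, 0] ∧
      (ρ''.1 genW).val = !![c * (-1 + a - b), c * (-1 + b + a); c * (1 + b + a), c * (-1 - a + b)] := by
  have h2 : ∀ x y : R, 2 * x = 2 * y → x = y := fun x y h => by
    linear_combination c * h - (x - y) * hc
  obtain ⟨ρ₁, h₁, hD⟩ : ∃ ρ₁ : IntegralRep R (hurwitzRep f),
      integralRepSetoid R (hurwitzRep f) ρ' ρ₁ ∧
      a • (ρ₁.1 genV).val - b • ((ρ₁.1 genU).val * (ρ₁.1 genV).val) = !![-1, 0; 0, 1] := by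
    obtain ⟨p, q, r, x, y, z, hU, hV, hdU, hdV, huv⟩ := exists_genU_genV_form hinj ρ'
    set U := (ρ'.1 genU).val with hU'
    set V := (ρ'.1 genV).val with hV'
    -- `D` has trace zero and `D² = -(a² + b²) = 1`, and it is diagonal in the target model; `(1 -
    -- D)/2` is a rank-one idempotent.
    set D := a • V - b • (U * V) with hD
    have hDval : D = !![a * x - b * (p * x + q * z), a * y - b * (p * y - q * x);
        a * z - b * (r * x - p * z), -(a * x - b * (p * x + q * z))] := by
      rw [hD, hU, hV]
      ext i j
      fin_cases i <;> fin_cases j <;> simp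
      · ring
      · ring
      · linear_combination -b * huv
    have hD1 : D 1 1 = - D 0 0 := by rw [hDval]; simp
    have hdD : D 0 0 * D 1 1 - D 0 1 * D 1 0 = -1 := by
      rw [hDval]
      simp only [Matrix.of_apply, Matrix.cons_val]
      linear_combination -(a ^ 2 + b ^ 2) * hdV + b ^ 2 * (x ^ 2 + y * z) * hdU + hab +
        (b * a * x - b ^ 2 * (p * x + q * z)) * huv
    obtain ⟨h, hh⟩ := Matrix.exists_diagonalize_idempotent (c • (1 - D)) (by
      simp [hD1]
      linear_combination hc) (by
      rw [hD1] at hdD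
      simp [hD1]
      linear_combination c ^ 2 * hdD)
    have hDh : D * h.val = h.val * !![-1, 0; 0, 1] := by
      have h1 : D = 1 - (2 : R) • (c • (1 - D)) := by
        rw [smul_smul, hc, one_smul, sub_sub_cancel]
      rw [h1, sub_mul, one_mul, smul_mul_assoc, hh]
      have h3 : (!![-1, 0; 0, 1] : Matrix (Fin 2) (Fin 2) R) = 1 - (2 : R) • !![1, 0; 0, 0] := by
        ext i j
        fin_cases i <;> fin_cases j <;> simp
        norm_num
      rw [h3, mul_sub, mul_one, mul_smul_comm]
    refine ⟨ρ'.conj h, ρ'.conj_equiv h, ?_⟩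
    have hc : ∀ x, ((ρ'.conj h).1 x).val = (h⁻¹).val * (ρ'.1 x).val * h.val := fun x => by
      change (h⁻¹ * ρ'.1 x * h⁻¹⁻¹ : GL (Fin 2) R).val = _
      rw [inv_inv]; rfl
    rw [hc, hc, ← hU', ← hV']
    calc _ = (h⁻¹).val * (D * h.val) := by
          simp only [hD, mul_sub, sub_mul, mul_smul_comm, smul_mul_assoc, mul_assoc,
            Units.mul_inv_cancel_left]
      _ = _ := by rw [hDh, Units.inv_mul_cancel_left]
  obtain ⟨p, q, r, x, y, z, hU, hV, hdU, hdV, huv⟩ := exists_genU_genV_form hinj ρ₁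
  rw [hU, hV] at hD
  have e00 := congrFun (congrFun hD 0) 0
  have e01 := congrFun (congrFun hD 0) 1
  have e10 := congrFun (congrFun hD 1) 0
  have e11 := congrFun (congrFun hD 1) 1
  simp at e00 e01 e10 e11
  -- With `D` diagonal, `tr UD = 0` reads `-2p = 0`. The entries of `V` below come from `V = -(aD +
  -- bUD)`.
  obtain rfl : p = 0 := h2 _ _ (by
    linear_combination p * e00 + q * e10 + r * e01 - p * e11 - a * huv)
  have hqr : q * r = -1 := by linear_combination hdU
  obtain rfl : x = a := by
    linear_combination -a * e00 - b * q * e10 - b ^ 2 * x * hqr + x * hab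
  obtain rfl : z = b * r := by
    linear_combination -x * e10 - b * r * e00 - b ^ 2 * z * hqr + z * hab
  obtain rfl : y = -b * q := by
    linear_combination -x * e01 - b * q * e11 - b ^ 2 * y * hqr + y * hab
  -- A diagonal change of basis keeps `D` and normalises `U`, since `qr = -1`.
  obtain ⟨h, hh⟩ := Matrix.exists_GL_val_eq !![-q, 0; 0, 1] (by
    rw [Matrix.det_fin_two_of]
    exact IsUnit.of_mul_eq_one r (by linear_combination -hqr))
  have hU₂ : ((ρ₁.conj h).1 genU).val = !![0, -1; 1, 0] := ρ₁.conj_val_eq h (by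
    rw [hU, hh]
    ext i j
    fin_cases i <;> fin_cases j <;> simp [Matrix.mul_apply, Fin.sum_univ_two]
    linear_combination -hqr)
  have hV₂ : ((ρ₁.conj h).1 genV).val = !![x, b; b, -x] := ρ₁.conj_val_eq h (by
    rw [hV, hh]
    ext i j
    fin_cases i <;> fin_cases j <;> simp [Matrix.mul_apply, Fin.sum_univ_two]
    · ring
    · ring
    · linear_combination -b * hqr)
  refine ⟨ρ₁.conj h, (integralRepSetoid R _).trans' h₁ (ρ₁.conj_equiv h), hU₂, ?_⟩
  have hw := two_mul_genW hinj (ρ₁.conj h)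
  rw [hU₂, hV₂] at hw
  set W := ((ρ₁.conj h).1 genW).val
  ext i j
  apply h2
  have e := congrFun (congrFun hw i) j
  rw [Matrix.smul_apply, smul_eq_mul] at e
  rw [e]
  fin_cases i <;> fin_cases j <;> simp
  · linear_combination -(-1 + x - b) * hc
  · linear_combination -(-1 + b + x) * hc
  · linear_combination -(1 + b + x) * hc
  · linear_combination -(-1 - x + b) * hc

theorem card_integralForms_of_two_isUnit [IsLocalRing R] (hinj : Function.Injective (algebraMap R E))
    {a b c : R} (hab : a ^ 2 + b ^ 2 = -1) (hc : 2 * c = 1) :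
    ENat.card (IntegralForms R (hurwitzRep f)) = 1 := by
  apply card_integralForms_eq_one
  · obtain ⟨ρE, -, hU, hW⟩ := exists_standard_form (f := f) (R := E) Function.injective_id
      (a := algebraMap R E a) (b := algebraMap R E b) (c := algebraMap R E c)
      (by rw [← map_pow, ← map_pow, ← map_add, hab, map_neg, map_one])
      (by rw [← map_ofNat (algebraMap R E) 2, ← map_mul, hc, map_one]) (self (hurwitzRep f))
    obtain ⟨ρ', -⟩ := exists_of_gens hinj ρE
      !![c * (-1 + a - b), c * (-1 + b + a); c * (1 + b + a), c * (-1 - a + b)]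
      !![0, -1; 1, 0] (by
      rw [hW]; ext i j; fin_cases i <;> fin_cases j <;> simp) (by
      rw [hU]; ext i j; fin_cases i <;> fin_cases j <;> simp)
    exact ⟨ρ'⟩
  · intro ρ₁ ρ₂
    obtain ⟨σ₁, h₁, hU₁, hW₁⟩ := exists_standard_form hinj hab hc ρ₁
    obtain ⟨σ₂, h₂, hU₂, hW₂⟩ := exists_standard_form hinj hab hc ρ₂
    refine (integralRepSetoid R _).trans' h₁ ((integralRepSetoid R _).trans' ?_
      ((integralRepSetoid R _).symm' h₂))
    exact equiv_of_gens 1 (by rw [hW₁, hW₂]; simp) (by rw [hU₁, hU₂]; simp)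

end OddResidue

end IntegralRep

/-! ### Counting classes by an invariant of normal forms -/

/-- A quotient whose classes have normal forms separated by an invariant `F` is counted by the
values of `F` on normal forms. -/
theorem ENat.card_quotient_eq_encard_image {α β : Type*} (s : Setoid α) (P : α → Prop) (F : α → β)
    (hP : ∀ a, ∃ b, P b ∧ s a b) (hF : ∀ a b, P a → P b → (s a b ↔ F a = F b)) :
    ENat.card (Quotient s) = (F '' {a | P a}).encard := by
  have hrep : ∀ c : Quotient s, ∃ a, P a ∧ Quotient.mk s a = c := by
    rintro ⟨a⟩
    obtain ⟨b, hb, hab⟩ := hP a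
    exact ⟨b, hb, Quotient.sound (s.symm' hab)⟩
  choose rep hrepP hrep using hrep
  have hinj : Function.Injective (F ∘ rep) := fun c d h => by
    rw [← hrep c, ← hrep d]
    exact Quotient.sound ((hF _ _ (hrepP c) (hrepP d)).2 h)
  have hrange : Set.range (F ∘ rep) = F '' {a | P a} := by
    ext γ
    constructor
    · rintro ⟨c, rfl⟩
      exact ⟨rep c, hrepP c, rfl⟩
    · rintro ⟨a, ha, rfl⟩
      exact ⟨Quotient.mk s a, (hF _ _ (hrepP _) ha).1 (Quotient.exact (hrep _))⟩
  rw [← hrange, ← ENat.card_coe_set_eq]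
  exact ENat.card_congr (Equiv.ofInjective _ hinj)

namespace IntegralRep

/-! ### A cube root of unity present: diagonal form -/

section Diagonal

variable {R E : Type*} [CommRing R] [Field E] [CharZero E] [Algebra R E] {f : HamiltonSplitting E}

/-- If `R` contains a primitive cube root of unity and `1/3`, then `𝐰` can be diagonalised. -/
theorem exists_diag_form [IsLocalRing R] (hinj : Function.Injective (algebraMap R E)) {ω t : R}
    (hω : ω ^ 2 + ω + 1 = 0) (ht : 3 * t = 1) (ρ' : IntegralRep R (hurwitzRep f)) :
    ∃ ρ'' : IntegralRep R (hurwitzRep f), (ρ''.1 genW).val = !![ω, 0; 0, -1 - ω] ∧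
      integralRepSetoid R (hurwitzRep f) ρ' ρ'' := by
  obtain ⟨htr, hd⟩ := trace_det_genW hinj ρ'
  set X := (ρ'.1 genW).val with hX
  have h11 : X 1 1 = -1 - X 0 0 := by linear_combination htr
  rw [h11] at hd
  set s : R := 2 * ω + 1 with hs
  have hs2 : s ^ 2 = -3 := by rw [hs]; linear_combination 4 * hω
  -- The projector `(W - ω²)/(ω - ω²)` onto the `ω`-eigenspace: `ω - ω² = s` has inverse `-s/3`.
  obtain ⟨h, hh⟩ := Matrix.exists_diagonalize_idempotent ((-(s * t)) • (X + (1 + ω) • 1)) (by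
    simp [h11]
    linear_combination -t * hs2 + ht + s * t * hs) (by
    simp [h11]
    linear_combination s ^ 2 * t ^ 2 * (hω + hd))
  refine ⟨ρ'.conj h, ρ'.conj_val_eq h ?_, ρ'.conj_equiv h⟩
  have h1 : X = s • ((-(s * t)) • (X + (1 + ω) • 1)) - (1 + ω) • 1 := by
    rw [smul_smul, show s * -(s * t) = 1 by linear_combination -t * hs2 + ht, one_smul,
      add_sub_cancel_right]
  have h2 : (!![ω, 0; 0, -1 - ω] : Matrix (Fin 2) (Fin 2) R) = s • !![1, 0; 0, 0] - (1 + ω) • 1 := by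
    ext i j
    fin_cases i <;> fin_cases j <;> simp [hs] <;> ring
  rw [← hX, h2, mul_sub, mul_smul_comm, ← hh]
  nth_rewrite 1 [h1]
  simp only [sub_mul, smul_mul_assoc, one_mul, mul_smul_comm, mul_one]

/-- The equation `tr WU = -1` says `(2ω + 1) U₀₀ = -1`, which fixes the diagonal; the determinant
then fixes the product `qr`. -/
theorem genU_of_diag (hinj : Function.Injective (algebraMap R E)) {ω t : R}
    (hω : ω ^ 2 + ω + 1 = 0) (ht : 3 * t = 1) (ρ' : IntegralRep R (hurwitzRep f))
    (hW : (ρ'.1 genW).val = !![ω, 0; 0, -1 - ω]) :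
    ∃ q r : R, (ρ'.1 genU).val = !![(2 * ω + 1) * t, q; r, -((2 * ω + 1) * t)] ∧
      3 * (q * r) = -2 := by
  obtain ⟨htr, hd⟩ := trace_det_genU hinj ρ'
  have hwu := trace_genW_mul_genU hinj ρ'
  rw [hW] at hwu
  set U := (ρ'.1 genU).val
  simp at hwu
  have h11 : U 1 1 = - U 0 0 := by linear_combination htr
  rw [h11] at hwu hd
  have h00 : U 0 0 = (2 * ω + 1) * t := by
    linear_combination -t * (2 * ω + 1) * hwu - U 0 0 * ht + 4 * t * U 0 0 * hω
  refine ⟨U 0 1, U 1 0, ?_, ?_⟩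
  · ext i j
    fin_cases i <;> fin_cases j <;> simp [h00, h11]
  · rw [h00] at hd
    linear_combination -3 * hd - (3 * t + 1) * ht * (-1) - 12 * t ^ 2 * hω

variable {N : AbsoluteValue E ℝ}

/-- As `ω - ω²` is a unit, matrices commuting with `W` are diagonal, and they rescale `q` by a unit.
Conversely `diag(q₂/q₁, 1)` conjugates the forms, `r` following from the fixed product `qr`. -/
theorem equiv_iff_of_diag (hinj : Function.Injective (algebraMap R E))
    (hR : ∀ x, N x ≤ 1 ↔ x ∈ Set.range (algebraMap R E)) {ω t : R}
    (hω : ω ^ 2 + ω + 1 = 0) (ht : 3 * t = 1) (ρ₁ ρ₂ : IntegralRep R (hurwitzRep f))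
    (hW₁ : (ρ₁.1 genW).val = !![ω, 0; 0, -1 - ω]) (hW₂ : (ρ₂.1 genW).val = !![ω, 0; 0, -1 - ω]) :
    integralRepSetoid R (hurwitzRep f) ρ₁ ρ₂ ↔
      N (algebraMap R E ((ρ₁.1 genU).val 0 1)) = N (algebraMap R E ((ρ₂.1 genU).val 0 1)) := by
  obtain ⟨q₁, r₁, hU₁, hqr₁⟩ := genU_of_diag hinj hω ht ρ₁ hW₁
  obtain ⟨q₂, r₂, hU₂, hqr₂⟩ := genU_of_diag hinj hω ht ρ₂ hW₂
  have hs : (2 * ω + 1) * -((2 * ω + 1) * t) = 1 := by linear_combination ht - 4 * t * hω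
  have hone : ∀ x : R, N (algebraMap R E x) = 1 ↔ IsUnit x := fun x =>
    (isUnit_iff_abs_eq_one hinj hR x).symm
  rw [hU₁, hU₂]
  simp only [Matrix.of_apply, Matrix.cons_val]
  constructor
  · rintro ⟨h, hh⟩
    have hw : (ρ₂.1 genW).val * h.val = h.val * (ρ₁.1 genW).val :=
      congrArg Units.val (mul_eq_of_eq_mul_inv (hh genW))
    have hu : (ρ₂.1 genU).val * h.val = h.val * (ρ₁.1 genU).val :=
      congrArg Units.val (mul_eq_of_eq_mul_inv (hh genU))
    rw [hW₁, hW₂] at hw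
    rw [hU₁, hU₂] at hu
    have w01 := congrFun (congrFun hw 0) 1
    have w10 := congrFun (congrFun hw 1) 0
    have u01 := congrFun (congrFun hu 0) 1
    simp [Matrix.mul_apply, Fin.sum_univ_two] at w01 w10 u01
    have h01 : h.val 0 1 = 0 := by
      linear_combination (-((2 * ω + 1) * t)) * w01 - h.val 0 1 * hs
    have h10 : h.val 1 0 = 0 := by
      linear_combination ((2 * ω + 1) * t) * w10 - h.val 1 0 * hs
    have hdet := h.isUnit
    rw [Matrix.isUnit_iff_isUnit_det, Matrix.det_fin_two, h01, zero_mul, sub_zero] at hdet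
    rw [h01] at u01
    have key : q₂ * h.val 1 1 = h.val 0 0 * q₁ := by linear_combination u01
    have := congrArg (fun x => N (algebraMap R E x)) key
    simp only [map_mul] at this
    rw [(hone _).2 (isUnit_of_mul_isUnit_left hdet), (hone _).2 (isUnit_of_mul_isUnit_right hdet)]
      at this
    linarith
  · intro hN
    have hq : ∀ q r : R, 3 * (q * r) = -2 → algebraMap R E q ≠ 0 := by
      intro q r h h0
      have := congrArg (algebraMap R E) h
      rw [map_mul, map_mul, h0, zero_mul, mul_zero, map_neg, map_ofNat] at this
      norm_num at this
    have hq₁ := hq q₁ r₁ hqr₁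
    have hc : N (algebraMap R E q₂ / algebraMap R E q₁) = 1 := by
      rw [map_div₀, ← hN, div_self ((AbsoluteValue.ne_zero_iff _).2 hq₁)]
    obtain ⟨c, hc'⟩ := (hR _).1 hc.le
    have hcq : c * q₁ = q₂ := hinj (by rw [map_mul, hc', div_mul_cancel₀ _ hq₁])
    have hrc : r₂ * c = r₁ := by
      have h3 : q₁ * (r₂ * c) = q₁ * r₁ := by
        linear_combination t * (hqr₂ - hqr₁) + 3 * t * r₂ * hcq +
          (q₁ * r₁ - q₁ * r₂ * c) * ht
      apply hinj
      have h4 := congrArg (algebraMap R E) h3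
      rw [map_mul, map_mul _ q₁ r₁] at h4
      exact mul_left_cancel₀ hq₁ h4
    have hcu : IsUnit c := by rwa [← hone, hc']
    obtain ⟨h, hh⟩ := Matrix.exists_GL_val_eq !![c, 0; 0, 1] (by
      rw [Matrix.det_fin_two_of]; simpa using hcu)
    refine equiv_of_gens h ?_ ?_
    · rw [hW₁, hW₂, hh]
      ext i j
      fin_cases i <;> fin_cases j <;> simp [Matrix.mul_apply, Fin.sum_univ_two]
      ring
    · rw [hU₁, hU₂, hh]
      ext i j
      fin_cases i <;> fin_cases j <;> simp [Matrix.mul_apply, Fin.sum_univ_two]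
      · ring
      · exact hcq.symm
      · exact hrc

/-- From `qr = -2/3` one gets `|q||r| = |2|`, so integrality of both entries means `|2| ≤ |q| ≤ 1`.
Every such `q` is reached by a diagonal conjugation over `E`. -/
theorem image_abs_of_diag [IsLocalRing R] (hinj : Function.Injective (algebraMap R E))
    (hR : ∀ x, N x ≤ 1 ↔ x ∈ Set.range (algebraMap R E)) {ω t : R}
    (hω : ω ^ 2 + ω + 1 = 0) (ht : 3 * t = 1) :
    (fun ρ' : IntegralRep R (hurwitzRep f) => N (algebraMap R E ((ρ'.1 genU).val 0 1))) ''
      {ρ' | (ρ'.1 genW).val = !![ω, 0; 0, -1 - ω]} =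
    {γ | ∃ q : E, N q = γ ∧ N 2 ≤ γ ∧ γ ≤ 1} := by
  have h3 : N 3 = 1 := by
    have := (isUnit_iff_abs_eq_one hinj hR 3).1 (IsUnit.of_mul_eq_one t ht)
    rwa [map_ofNat] at this
  have h2 : N 2 ≠ 0 := (AbsoluteValue.ne_zero_iff _).2 two_ne_zero
  ext γ
  constructor
  · rintro ⟨ρ', hW, rfl⟩
    obtain ⟨q, r, hU, hqr⟩ := genU_of_diag hinj hω ht ρ' hW
    refine ⟨_, rfl, ?_, (hR _).2 ⟨_, rfl⟩⟩
    beta_reduce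
    rw [hU]
    simp only [Matrix.of_apply, Matrix.cons_val]
    have := congrArg (fun x => N (algebraMap R E x)) hqr
    simp only [map_mul, map_neg, map_neg_eq_map, map_ofNat, h3, one_mul] at this
    rw [← this]
    exact mul_le_of_le_one_right (N.nonneg _) ((hR _).2 ⟨_, rfl⟩)
  · rintro ⟨q, rfl, hq2, hq1⟩
    have hq0 : q ≠ 0 := by
      rintro rfl
      rw [map_zero] at hq2
      exact h2 (le_antisymm hq2 (N.nonneg _))
    have hω' : algebraMap R E ω ^ 2 + algebraMap R E ω + 1 = 0 := by
      rw [← map_pow, ← map_add, ← map_one (algebraMap R E), ← map_add, hω, map_zero]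
    have ht' : 3 * algebraMap R E t = 1 := by
      rw [← map_ofNat (algebraMap R E) 3, ← map_mul, ht, map_one]
    obtain ⟨ρE, hW, -⟩ := exists_diag_form (f := f) (R := E) Function.injective_id hω' ht'
      (self (hurwitzRep f))
    obtain ⟨q₀, r₀, hU, hqr⟩ := genU_of_diag Function.injective_id hω' ht' ρE hW
    have hq₀ : q₀ ≠ 0 := by
      rintro rfl
      norm_num at hqr
    obtain ⟨h, hh⟩ := Matrix.exists_GL_val_eq !![q₀ / q, 0; 0, 1] (by
      rw [Matrix.det_fin_two_of]
      simpa using ⟨hq₀, hq0⟩)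
    have hW' : ((ρE.conj h).1 genW).val = !![algebraMap R E ω, 0; 0, -1 - algebraMap R E ω] :=
      ρE.conj_val_eq h (by
        rw [hW, hh]
        ext i j
        fin_cases i <;> fin_cases j <;> simp [Matrix.mul_apply, Fin.sum_univ_two]
        ring)
    have hU' : ((ρE.conj h).1 genU).val =
        !![(2 * algebraMap R E ω + 1) * algebraMap R E t, q; r₀ * (q₀ / q),
          -((2 * algebraMap R E ω + 1) * algebraMap R E t)] :=
      ρE.conj_val_eq h (by
        rw [hU, hh]
        ext i j
        fin_cases i <;> fin_cases j <;> simp [Matrix.mul_apply, Fin.sum_univ_two]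
        · ring
        · field_simp)
    obtain ⟨q', hq'⟩ := (hR q).1 hq1
    obtain ⟨r', hr'⟩ := (hR (r₀ * (q₀ / q))).1 (by
      have h4 : 3 * (r₀ * (q₀ / q)) * q = -2 := by
        field_simp
        linear_combination hqr
      have h5 := congrArg N h4
      rw [map_mul, map_mul, h3, one_mul, map_neg_eq_map] at h5
      have hpos : 0 < N q := N.pos hq0
      by_contra! hlt
      nlinarith)
    obtain ⟨ρ', hρW, hρU⟩ := exists_of_gens hinj (ρE.conj h) !![ω, 0; 0, -1 - ω]
      !![(2 * ω + 1) * t, q'; r', -((2 * ω + 1) * t)] (by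
      rw [hW']; ext i j; fin_cases i <;> fin_cases j <;> simp) (by
      rw [hU']; ext i j; fin_cases i <;> fin_cases j <;> simp [hq', hr', map_ofNat (algebraMap R E) 2])
    refine ⟨ρ', hρW, ?_⟩
    beta_reduce
    rw [hρU]
    simp [hq']

theorem card_integralForms_of_cubeRoot [IsLocalRing R] (hinj : Function.Injective (algebraMap R E))
    (hR : ∀ x, N x ≤ 1 ↔ x ∈ Set.range (algebraMap R E)) {ω t : R}
    (hω : ω ^ 2 + ω + 1 = 0) (ht : 3 * t = 1) :
    ENat.card (IntegralForms R (hurwitzRep f)) =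
      {γ | ∃ q : E, N q = γ ∧ N 2 ≤ γ ∧ γ ≤ 1}.encard := by
  rw [← image_abs_of_diag (f := f) hinj hR hω ht]
  exact ENat.card_quotient_eq_encard_image _ _ _ (exists_diag_form hinj hω ht)
    (fun ρ₁ ρ₂ h₁ h₂ => equiv_iff_of_diag hinj hR hω ht ρ₁ ρ₂ h₁ h₂)

end Diagonal

end IntegralRep

/-! ### The ramification index as a number of absolute values -/

section Ramification

theorem padicAbs_two {E : Type*} [Field E] [Algebra ℚ_[2] E] [Algebra.IsAlgebraic ℚ_[2] E] :
    padicAbs 2 E 2 = 1 / 2 := by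
  have h := padicAbs_natCast 2 (E := E) 2
  have h' := Padic.norm_p (p := 2)
  rw [h'] at h
  simpa using h

theorem padicAbs_three {E : Type*} [Field E] [Algebra ℚ_[2] E] [Algebra.IsAlgebraic ℚ_[2] E] :
    padicAbs 2 E 3 = 1 := by
  have h := padicAbs_intCast 2 (E := E) 3
  have h4 : ¬ ((2 : ℕ) : ℤ) ∣ (3 : ℤ) := by decide
  rw [← Padic.norm_intCast_lt_one_iff (p := 2)] at h4
  rw [le_antisymm (Padic.norm_int_le_one _) (not_lt.1 h4)] at h
  simpa using h

/-- The value group of `ℚ_2` is `2^ℤ`, for which `(1/2, 1]` is a fundamental domain. Counting with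
`encard` also covers infinite index. -/
theorem ramificationIndex_two_eq {E : Type*} [Field E] [Algebra ℚ_[2] E]
    [Algebra.IsAlgebraic ℚ_[2] E] :
    ramificationIndex 2 E = {γ | ∃ q : E, padicAbs 2 E q = γ ∧ 1 / 2 < γ ∧ γ ≤ 1}.encard := by
  set N := padicAbs 2 E with hNdef
  have hR := padicAbs_le_one_iff_range 2 (E := E)
  have hinj : Function.Injective (algebraMap (padicIntegers 2 E) E) := Subtype.val_injective
  have hnorm : ∀ c : ℚ_[2]ˣ, ∃ k : ℤ, N (algebraMap ℚ_[2] E c) = 2 ^ k := fun c =>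
    ⟨-(c : ℚ_[2]).valuation, by
      rw [hNdef, padicAbs_algebraMap, Padic.norm_eq_zpow_neg_valuation c.ne_zero]; norm_num⟩
  have himage : (fun x : Eˣ => N (x : E)) '' {x | 1 / 2 < N (x : E) ∧ N (x : E) ≤ 1} =
      {γ | ∃ q : E, N q = γ ∧ 1 / 2 < γ ∧ γ ≤ 1} := by
    ext γ
    constructor
    · rintro ⟨x, hx, rfl⟩
      exact ⟨x, rfl, hx⟩
    · rintro ⟨q, rfl, hq⟩
      have hq0 : q ≠ 0 := by
        rintro rfl
        rw [map_zero] at hq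
        norm_num at hq
      exact ⟨Units.mk0 q hq0, hq, rfl⟩
  rw [← himage]
  refine ENat.card_quotient_eq_encard_image (QuotientGroup.leftRel _) _ _ ?_ ?_
  · intro x
    -- Here `2^n < |x| ≤ 2^(n+1)`; multiplying by `2^(n+1)`, of absolute value `2^(-(n+1))`, moves
    -- `x` into the domain.
    obtain ⟨n, hn1, hn2⟩ := exists_mem_Ioc_zpow (N.pos x.ne_zero) (one_lt_two (α := ℝ))
    let c : ℚ_[2]ˣ := (Units.mk0 2 two_ne_zero) ^ (n + 1)
    have hc : N (algebraMap ℚ_[2] E c) = (2 ^ (n + 1))⁻¹ := by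
      simp only [c, Units.val_zpow_eq_zpow_val, Units.val_mk0, map_zpow₀, map_ofNat]
      rw [hNdef, padicAbs_two, one_div, inv_zpow]
    refine ⟨x * Units.map (algebraMap ℚ_[2] E : ℚ_[2] →* E) c, ?_, ?_⟩
    · have h : N ((x * Units.map (algebraMap ℚ_[2] E : ℚ_[2] →* E) c : Eˣ) : E) =
          N (x : E) / 2 ^ (n + 1) := by
        rw [Units.val_mul, map_mul, div_eq_mul_inv, ← hc]; rfl
      have hpos : (0 : ℝ) < 2 ^ (n + 1) := by positivity
      rw [h]
      refine ⟨?_, (div_le_one hpos).2 hn2⟩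
      rw [lt_div_iff₀ hpos, zpow_add_one₀ two_ne_zero]
      linarith
    · rw [QuotientGroup.leftRel_apply, inv_mul_cancel_left]
      exact Subgroup.mem_sup_left ⟨c, rfl⟩
  · intro x y hx hy
    have hxpos : 0 < N (x : E) := N.pos x.ne_zero
    rw [QuotientGroup.leftRel_apply, Subgroup.mem_sup]
    constructor
    · rintro ⟨_, ⟨c, rfl⟩, _, ⟨o, rfl⟩, h⟩
      have hy' : (y : E) = x * (algebraMap ℚ_[2] E c * algebraMap (padicIntegers 2 E) E o) := by
        have := congrArg Units.val (eq_mul_of_inv_mul_eq h.symm)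
        exact this
      obtain ⟨k, hk⟩ := hnorm c
      have ho := (isUnit_iff_abs_eq_one hinj hR (o : padicIntegers 2 E)).1 o.isUnit
      have hNy : N (y : E) = N (x : E) * 2 ^ k := by
        rw [hy', map_mul, map_mul, hk, ho, mul_one]
      have hk0 : k = 0 := by
        rcases lt_trichotomy k 0 with h0 | h0 | h0
        · have : (2 : ℝ) ^ k ≤ 2 ^ (-1 : ℤ) := zpow_le_zpow_right₀ one_le_two (by omega)
          norm_num at this
          nlinarith [hx.2, hy.1]
        · exact h0
        · have : (2 : ℝ) ^ (1 : ℤ) ≤ 2 ^ k := zpow_le_zpow_right₀ one_le_two (by omega)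
          norm_num at this
          nlinarith [hx.1, hy.2]
      rw [hNy, hk0, zpow_zero, mul_one]
    · intro h
      have h1 : N ((x⁻¹ * y : Eˣ) : E) = 1 := by
        rw [Units.val_mul, map_mul, Units.val_inv_eq_inv_val, map_inv₀, ← h,
          inv_mul_cancel₀ hxpos.ne']
      obtain ⟨o, ho⟩ := (hR _).1 h1.le
      have hou : IsUnit o := (isUnit_iff_abs_eq_one hinj hR o).2 (by rw [ho]; exact h1)
      exact ⟨1, one_mem _, _, ⟨hou.unit, rfl⟩, by
        rw [one_mul]
        exact Units.ext ho⟩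

end Ramification

end

/-! ### Assembling the two cases -/

theorem theorem3 :
    (∀ (E : Type*) [Field E] [CharZero E] [Algebra ℚ_[2] E] [IsGalois ℚ_[2] E],
      (∃ F : IntermediateField ℚ_[2] E, Module.finrank ℚ_[2] F = 2) →
        Nonempty (HamiltonSplitting E) ∧
        ∀ f : HamiltonSplitting E,
          (IsSquare (-3 : E) →
            ENat.card (IntegralForms (padicIntegers 2 E) (hurwitzRep f)) =
              ramificationIndex 2 E + 1) ∧
          (¬ IsSquare (-3 : E) →
            ENat.card (IntegralForms (padicIntegers 2 E) (hurwitzRep f)) = 1)) ∧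
    (∀ (p : ℕ) [Fact p.Prime], p ≠ 2 →
      ∀ (E : Type*) [Field E] [CharZero E] [Algebra ℚ_[p] E] [Algebra.IsAlgebraic ℚ_[p] E],
        Nonempty (HamiltonSplitting E) ∧
        ∀ f : HamiltonSplitting E,
          ENat.card (IntegralForms (padicIntegers p E) (hurwitzRep f)) = 1) := by
  constructor
  · intro E _ _ _ _ hF
    obtain ⟨a, b, hab⟩ := exists_sq_add_sq_of_quadratic hF
    refine ⟨nonempty_hamiltonSplitting hab, fun f => ?_⟩
    have hR := padicAbs_le_one_iff_range 2 (E := E)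
    have hinj : Function.Injective (algebraMap (padicIntegers 2 E) E) := Subtype.val_injective
    have hloc : IsLocalRing (padicIntegers 2 E) := isLocalRing_of_abs (padicAbs_add_le 2) hinj hR
    constructor
    · rintro ⟨s, hs⟩
      have hω : ((s - 1) / 2) ^ 2 + (s - 1) / 2 + 1 = 0 := by
        field_simp
        linear_combination -hs
      have hint : IsIntegral (PadicInt.subring 2) ((s - 1) / 2) := by
        refine IsIntegral.of_pow (n := 3) (by decide) ?_
        rw [show ((s - 1) / 2) ^ 3 = 1 by linear_combination ((s - 1) / 2 - 1) * hω]
        exact isIntegral_one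
      obtain ⟨t, ht⟩ := ((isUnit_iff_abs_eq_one hinj hR 3).2
        (by rw [map_ofNat]; exact padicAbs_three)).exists_right_inv
      rw [IntegralRep.card_integralForms_of_cubeRoot (N := padicAbs 2 E) hinj hR
        (ω := ⟨(s - 1) / 2, hint⟩) (t := t) (Subtype.ext hω) ht, ramificationIndex_two_eq,
        padicAbs_two, ← Set.encard_insert_of_notMem (a := (1 / 2 : ℝ))]
      -- The closed interval exceeds the half-open one by the endpoint `1/2`, attained at `2`: this
      -- is the extra `+ 1`.
      · congr 1
        ext γ
        constructor
        · rintro ⟨q, hq, h1, h2⟩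
          rcases h1.eq_or_lt with h | h
          · exact Or.inl h.symm
          · exact Or.inr ⟨q, hq, h, h2⟩
        · rintro (rfl | ⟨q, hq, h1, h2⟩)
          · exact ⟨2, padicAbs_two, le_rfl, by norm_num⟩
          · exact ⟨q, hq, h1.le, h2⟩
      · rintro ⟨q, -, h, -⟩
        exact lt_irrefl _ h
    · intro hns
      have hω : ∀ x : E, x ^ 2 + x + 1 ≠ 0 := fun x hx =>
        hns ⟨2 * x + 1, by linear_combination -4 * hx⟩
      exact IntegralRep.card_integralForms_of_no_cubeRoot (padicAbs_add_le 2) hinj hR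
        padicAbs_three (fun x hx => padicAbs_sq_add_self_add_one hω hx) hω
  · intro p _ hp E _ _ _ _
    obtain ⟨a, b, hab⟩ := PadicInt.exists_sq_add_sq_eq_neg_one p hp
    have hR := padicAbs_le_one_iff_range p (E := E)
    have hinj : Function.Injective (algebraMap (padicIntegers p E) E) := Subtype.val_injective
    have hloc : IsLocalRing (padicIntegers p E) := isLocalRing_of_abs (padicAbs_add_le p) hinj hR
    have hmem : ∀ x : ℤ_[p], ∃ y : padicIntegers p E,
        algebraMap _ E y = algebraMap ℚ_[p] E (x : ℚ_[p]) := fun x =>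
      (hR _).1 (by rw [padicAbs_algebraMap]; exact x.2)
    obtain ⟨a', ha'⟩ := hmem a
    obtain ⟨b', hb'⟩ := hmem b
    have hab' : a' ^ 2 + b' ^ 2 = -1 := by
      apply hinj
      have h := congrArg (fun x : ℤ_[p] => algebraMap ℚ_[p] E (x : ℚ_[p])) hab
      push_cast at h
      simp only [map_add, map_pow, map_neg, map_one, ha', hb'] at h ⊢
      exact h
    refine ⟨nonempty_hamiltonSplitting (a := algebraMap _ E a') (b := algebraMap _ E b') (by
      rw [← map_pow, ← map_pow, ← map_add, hab', map_neg, map_one]), fun f => ?_⟩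
    have h2 : padicAbs p E 2 = 1 := by
      have h := padicAbs_intCast p (E := E) 2
      have h4 : ¬ (p : ℤ) ∣ (2 : ℤ) := by
        intro h
        have h' : p ∣ 2 := by exact_mod_cast h
        exact hp ((Nat.prime_dvd_prime_iff_eq Fact.out Nat.prime_two).1 h')
      rw [← Padic.norm_intCast_lt_one_iff (p := p)] at h4
      rw [le_antisymm (Padic.norm_int_le_one _) (not_lt.1 h4)] at h
      simpa using h
    obtain ⟨c, hc⟩ := ((isUnit_iff_abs_eq_one hinj hR 2).2
      (by rw [map_ofNat]; exact h2)).exists_right_inv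
    exact IntegralRep.card_integralForms_of_two_isUnit hinj hab' hc
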